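/- All $C^*$-algebras are unital (the zero algebra is allowed). A \emph{PU map} of $C^*$-algebras is a linear map that preserves positive elements (those of the form $y^*y$) and the unit; $\mathbf{Cstar}_{PU}$ is the category of $C^*$-algebras and PU maps. For a $C^*$-algebra $A$ let $\mathrm{Stat}(A)$ be the compact Hausdorff space of states, i.e. of PU maps $A\to\mathbb C$, with the weak-* topology, and let $[0,1]_A=\{a\in A: 0\le a\le 1\}$ be its set of effects. An effect module is an effect algebra (a partial commutative monoid $(M,0,\oplus)$ with orthocomplement $(-)^\perp$) with an action of the multiplicative monoid $[0,1]$ that preserves the partial sums in each variable; $\mathbf{EMod}$ is the category of effect modules and maps preserving $\oplus$, $1=0^\perp$ and the action. Examples are $[0,1]\subseteq\mathbb R$, $\mathrm{Cont}(X,[0,1])$ for a topological space $X$, and $[0,1]_A$. The Radon monad $\mathcal R$ on compact Hausdorff spaces is $\mathcal R(X)=\mathrm{Stat}(C(X,\mathbb C))$, $\mathcal R(g)(\nu)(v)=\nu(v\circ g)$, with unit $\eta(x)(v)=v(x)$ and multiplication $\mu(g)(v)=g(h\mapsto h(v))$; $\mathcal{K}\ell(\mathcal R)$ and $\mathcal{EM}(\mathcal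 R)$ are its Kleisli and Eilenberg--Moore categories. An algebra $\alpha:\mathcal R(X)\to X$ has convex sums $\sum_i r_ix_i:=\alpha\bigl(v\mapsto\sum_i r_iv(x_i)\bigr)$, and $\mathcal A(X,[0,1])$ is the effect module, with pointwise operations, of the continuous functions $X\to[0,1]$ that preserve convex sums. For an effect module $M$, the set $\mathbf{EMod}(M,[0,1])$ with the topology of pointwise convergence is an $\mathcal R$-algebra with structure map $h\mapsto(x\mapsto h(\mathrm{ev}_x))$, where $\mathrm{ev}_x(f)=f(x)$. The space $\mathrm{Stat}(A)$ is an $\mathcal R$-algebra with structure map sending $\nu$ to its barycentre $a\mapsto\nu(\mathrm{ev}_a)$, where $\mathrm{ev}_a(s)=s(a)$. \textbf{Theorem.} Consider the functors $\mathcal A(-,[0,1]):\mathcal{EM}(\mathcal R)\to\mathbf{EMod}^{op}$ and $\mathbf{EMod}(-,[0,1]):\mathbf{EMod}^{op}\to\mathcal{EM}(\mathcal R)$, both acting on maps by precomposition; the predicate functors $\mathrm{Cont}(-,[0,1]):\mathcal{K}\ell(\mathcal R)\to\mathbf{EMod}^{op}$, sending $f:X\to\mathcal R(Y)$ to $p\mapsto(x\mapsto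 f(x)(p))$, and $[0,1]_{(-)}:(\mathbf{Cstar}_{PU})^{op}\to\mathbf{EMod}^{op}$, acting by restriction; and the state functors $K:\mathcal{K}\ell(\mathcal R)\to\mathcal{EM}(\mathcal R)$ (the comparison functor, $X\mapsto(\mathcal R(X),\mu)$, $f\mapsto\mu\circ\mathcal R(f)$) and $\mathrm{Stat}:(\mathbf{Cstar}_{PU})^{op}\to\mathcal{EM}(\mathcal R)$, acting by precomposition. (1) $\mathcal A(-,[0,1])$ is left adjoint to $\mathbf{EMod}(-,[0,1])$, the bijection $\mathbf{EMod}(M,\mathcal A(X,[0,1]))\cong\mathcal{EM}(\mathcal R)(X,\mathbf{EMod}(M,[0,1]))$ being given by exchanging the arguments. (2) The state-and-effect triangle over $\mathcal{K}\ell(\mathcal R)$ commutes up to natural isomorphism in both directions: $K\cong\mathbf{EMod}(\mathrm{Cont}(-,[0,1]),[0,1])$ in $\mathcal{EM}(\mathcal R)$, by $\nu\mapsto(p\mapsto\nu(p))$, and $\mathrm{Cont}(X,[0,1])\cong\mathcal A(\mathcal R(X),[0,1])$ in $\mathbf{EMod}$, naturally in $X\in\mathcal{K}\ell(\mathcal R)$,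 by $p\mapsto(\nu\mapsto\nu(p))$. (3) The state-and-effect triangle over $(\mathbf{Cstar}_{PU})^{op}$ commutes up to natural isomorphism in both directions: for every $C^*$-algebra $A$, naturally in $A$, $\mathrm{Stat}(A)\cong\mathbf{EMod}([0,1]_A,[0,1])$ in $\mathcal{EM}(\mathcal R)$, by $s\mapsto(a\mapsto s(a))$, and $[0,1]_A\cong\mathcal A(\mathrm{Stat}(A),[0,1])$ in $\mathbf{EMod}$, by $a\mapsto(s\mapsto s(a))$. -/

import Mathlib

open CategoryTheory

universe u v w

noncomputable section

namespace StateEffect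

/-! ### Effect modules -/

/-- An effect algebra: a partial commutative monoid `(M, 0, ⊕)` with an orthocomplement.
The partial operation is given by its graph: `osum x y z` means that
`x ⊕ y` is defined (`x ⊥ y`) and equal to `z`. -/
class EffectAlgebra (M : Type u) where
  zero : M
  one : M
  compl : M → M
  osum : M → M → M → Prop
  osum_unique : ∀ {x y z z' : M}, osum x y z → osum x y z' → z = z'
  osum_comm : ∀ {x y z : M}, osum x y z → osum y x z
  osum_assoc : ∀ {x y z a b : M}, osum x y a → osum a z b → ∃ c, osum y z c ∧ osum x c b
  zero_osum : ∀ x : M, osum zero x x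
  osum_compl : ∀ x : M, osum x (compl x) one
  eq_compl : ∀ {x y : M}, osum x y one → y = compl x
  eq_zero_of_one_osum : ∀ {x z : M}, osum one x z → x = zero

/-- An effect module: an effect algebra with an action of the multiplicative monoid `[0,1]`
which preserves the partial sums in each variable separately. -/
class EffectModule (M : Type u) extends EffectAlgebra M where
  smul : unitInterval → M → M
  one_smul : ∀ x : M, smul 1 x = x
  mul_smul : ∀ (r s : unitInterval) (x : M), smul (r * s) x = smul r (smul s x)
  smul_osum : ∀ (r : unitInterval) {x y z : M}, osum x y z → osum (smul r x) (smul r y) (smul r z)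
  add_smul : ∀ {r s t : unitInterval} (x : M), (r : ℝ) + s = t →
    osum (smul r x) (smul s x) (smul t x)

/-- A map of effect modules preserves `⊕`, `1` and the scalar multiplication. -/
@[ext]
structure EModHom (M : Type u) (N : Type v) [EffectModule M] [EffectModule N] where
  toFun : M → N
  map_osum : ∀ {x y z : M}, EffectAlgebra.osum x y z →
    EffectAlgebra.osum (toFun x) (toFun y) (toFun z)
  map_one : toFun EffectAlgebra.one = EffectAlgebra.one
  map_smul : ∀ (r : unitInterval) (x : M),
    toFun (EffectModule.smul r x) = EffectModule.smul r (toFun x)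

namespace EModHom

instance {M : Type u} {N : Type v} [EffectModule M] [EffectModule N] :
    FunLike (EModHom M N) M N where
  coe := EModHom.toFun
  coe_injective _ _ h := EModHom.ext h

def id (M : Type u) [EffectModule M] : EModHom M M where
  toFun x := x
  map_osum h := h
  map_one := rfl
  map_smul _ _ := rfl

def comp {M : Type u} {N : Type v} {P : Type w} [EffectModule M] [EffectModule N]
    [EffectModule P] (g : EModHom N P) (f : EModHom M N) : EModHom M P where
  toFun x := g (f x)
  map_osum h := g.map_osum (f.map_osum h)
  map_one := (congrArg g f.map_one).trans g.map_one
  map_smul r x := (congrArg g (f.map_smul r x)).trans (g.map_smul r _)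

end EModHom

/-- The objects of the category `EMod` of effect modules. -/
structure EModCat : Type (u + 1) where
  carrier : Type u
  [str : EffectModule carrier]

instance (M : EModCat.{u}) : EffectModule M.carrier := M.str

instance : Category EModCat.{u} where
  Hom M N := EModHom M.carrier N.carrier
  id M := EModHom.id M.carrier
  comp f g := EModHom.comp g f

/-- The real unit interval as an effect module; `r ⊕ s` is `r + s`, defined if `r + s ≤ 1`. -/
instance : EffectModule unitInterval where
  zero := 0
  one := 1
  compl := unitInterval.symm
  osum r s t := (r : ℝ) + s = t
  osum_unique h h' := Subtype.ext (h.symm.trans h')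
  osum_comm h := (add_comm _ _).trans h
  osum_assoc := by
    intro x y z a b h h'
    refine ⟨⟨(y : ℝ) + z, add_nonneg y.2.1 z.2.1, ?_⟩, rfl, ?_⟩
    · have := x.2.1; have := b.2.2; linarith
    · change (x : ℝ) + ((y : ℝ) + z) = b
      linarith
  zero_osum x := by simp
  osum_compl x := by simp
  eq_compl h := by
    apply Subtype.ext
    simp only [unitInterval.coe_symm_eq, Set.Icc.coe_one] at h ⊢
    linarith
  eq_zero_of_one_osum := by
    intro x z h
    apply Subtype.ext
    simp only [Set.Icc.coe_one, Set.Icc.coe_zero] at h ⊢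
    have := x.2.1; have := z.2.2; linarith
  smul r x := r * x
  one_smul := one_mul
  mul_smul := mul_assoc
  smul_osum r x y z h := by
    simp only [Set.Icc.coe_mul]
    rw [← h]; ring
  add_smul x h := by
    simp only [Set.Icc.coe_mul]
    rw [← h]; ring

/-- The effect module `Cont(X,[0,1])` with pointwise operations. -/
instance (X : Type u) [TopologicalSpace X] : EffectModule C(X, unitInterval) where
  zero := ContinuousMap.const X 0
  one := ContinuousMap.const X 1
  compl p := ⟨fun x => unitInterval.symm (p x), by fun_prop⟩
  osum p q r := ∀ x, (p x : ℝ) + q x = r x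
  osum_unique h h' := ContinuousMap.ext fun x => EffectAlgebra.osum_unique (h x) (h' x)
  osum_comm h x := (add_comm _ _).trans (h x)
  osum_assoc := by
    intro p q r a b h h'
    have key : ∀ x, (p x : ℝ) + (q x + r x) = b x := fun x => by
      have := h x; have := h' x; linarith
    refine ⟨⟨fun x => ⟨(q x : ℝ) + r x, add_nonneg (q x).2.1 (r x).2.1, ?_⟩, ?_⟩,
      fun x => rfl, key⟩
    · have := (p x).2.1; have := (b x).2.2; have := key x; linarith
    · fun_prop
  zero_osum p x := EffectAlgebra.zero_osum (p x)
  osum_compl p x := EffectAlgebra.osum_compl (p x)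
  eq_compl h := ContinuousMap.ext fun x => EffectAlgebra.eq_compl (h x)
  eq_zero_of_one_osum h := ContinuousMap.ext fun x => EffectAlgebra.eq_zero_of_one_osum (h x)
  smul r p := ⟨fun x => r * p x, by fun_prop⟩
  one_smul p := ContinuousMap.ext fun x => one_mul (p x)
  mul_smul r s p := ContinuousMap.ext fun x => mul_assoc r s (p x)
  smul_osum r p q s h x := EffectModule.smul_osum (x := p x) (y := q x) (z := s x) r (h x)
  add_smul p h x := EffectModule.add_smul (p x) h

/-! ### Unital C⋆-algebras, positive unital maps, effects -/

/-- Positive elements of a C⋆-algebra. The order is `a ≤ b ↔ IsPos (b - a)`. -/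
def IsPos {A : Type u} [CStarAlgebra A] (a : A) : Prop := ∃ y : A, a = star y * y

section Positivity

variable {A : Type u} [CStarAlgebra A]

theorem isPos_star_mul_self (y : A) : IsPos (star y * y) := ⟨y, rfl⟩

theorem isPos_zero : IsPos (0 : A) := ⟨0, by simp⟩

theorem isPos_one : IsPos (1 : A) := ⟨1, by simp⟩

theorem IsPos.add {a b : A} (ha : IsPos a) (hb : IsPos b) : IsPos (a + b) := by
  let := CStarAlgebra.spectralOrder A
  let := CStarAlgebra.spectralOrderedRing A
  unfold IsPos at *
  rw [← CStarAlgebra.nonneg_iff_eq_star_mul_self] at *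
  exact add_nonneg ha hb

theorem IsPos.eq_zero {a : A} (ha : IsPos a) (hb : IsPos (-a)) : a = 0 := by
  let := CStarAlgebra.spectralOrder A
  let := CStarAlgebra.spectralOrderedRing A
  unfold IsPos at *
  rw [← CStarAlgebra.nonneg_iff_eq_star_mul_self] at *
  exact le_antisymm (by simpa using hb) ha

theorem IsPos.smul {a : A} (ha : IsPos a) {r : ℝ} (hr : 0 ≤ r) : IsPos ((r : ℂ) • a) := by
  obtain ⟨y, rfl⟩ := ha
  refine ⟨((Real.sqrt r : ℝ) : ℂ) • y, ?_⟩
  have h : (star ((Real.sqrt r : ℝ) : ℂ)) * ((Real.sqrt r : ℝ) : ℂ) = (r : ℂ) := by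
    rw [Complex.star_def, Complex.conj_ofReal, ← Complex.ofReal_mul, Real.mul_self_sqrt hr]
  rw [star_smul, smul_mul_smul_comm, h]

end Positivity

/-- A positive unital (PU) map of C⋆-algebras. -/
@[ext]
structure PUMap (A : Type u) (B : Type v) [CStarAlgebra A] [CStarAlgebra B] where
  toLinearMap : A →ₗ[ℂ] B
  map_isPos : ∀ a : A, IsPos a → IsPos (toLinearMap a)
  map_one : toLinearMap 1 = 1

namespace PUMap

section

variable {A : Type u} {B : Type v} {C : Type w} [CStarAlgebra A] [CStarAlgebra B] [CStarAlgebra C]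

instance : FunLike (PUMap A B) A B where
  coe f := f.toLinearMap
  coe_injective _ _ h := PUMap.ext (DFunLike.coe_injective h)

instance : LinearMapClass (PUMap A B) ℂ A B where
  map_add f := f.toLinearMap.map_add
  map_smulₛₗ f := f.toLinearMap.map_smul

theorem funext {f g : PUMap A B} (h : ∀ a, f a = g a) : f = g := DFunLike.ext _ _ h

theorem isPos (f : PUMap A B) {a : A} (ha : IsPos a) : IsPos (f a) := f.map_isPos a ha

@[simp] theorem apply_one (f : PUMap A B) : f 1 = 1 := f.map_one

variable (A) in
def id : PUMap A A := ⟨LinearMap.id, fun _ h => h, rfl⟩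

def comp (g : PUMap B C) (f : PUMap A B) : PUMap A C where
  toLinearMap := g.toLinearMap ∘ₗ f.toLinearMap
  map_isPos _ h := g.isPos (f.isPos h)
  map_one := (congrArg g f.apply_one).trans g.apply_one

@[simp] theorem id_apply (a : A) : id A a = a := rfl

@[simp] theorem comp_apply (g : PUMap B C) (f : PUMap A B) (a : A) : comp g f a = g (f a) := rfl

end

end PUMap

/-- The objects of the category of unital C⋆-algebras and PU maps. -/
structure CStarPU : Type (u + 1) where
  carrier : Type u
  [str : CStarAlgebra carrier]

instance (A : CStarPU.{u}) : CStarAlgebra A.carrier := A.str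

instance : Category CStarPU.{u} where
  Hom A B := PUMap A.carrier B.carrier
  id A := PUMap.id A.carrier
  comp f g := PUMap.comp g f

/-- The effects `[0,1]_A`: elements `a` with `0 ≤ a ≤ 1`. -/
def Effect (A : Type u) [CStarAlgebra A] : Type u := {a : A // IsPos a ∧ IsPos (1 - a)}

/-- `[0,1]_A` is an effect module; `a ⊕ b` is `a + b`, defined if `a + b ≤ 1`. -/
instance (A : Type u) [CStarAlgebra A] : EffectModule (Effect A) where
  zero := ⟨0, isPos_zero, by simpa using isPos_one⟩
  one := ⟨1, isPos_one, by simpa using isPos_zero⟩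
  compl a := ⟨1 - a.1, a.2.2, by simpa using a.2.1⟩
  osum a b c := a.1 + b.1 = c.1
  osum_unique h h' := Subtype.ext (h.symm.trans h')
  osum_comm h := (add_comm _ _).trans h
  osum_assoc := by
    intro x y z a b h h'
    have key : x.1 + (y.1 + z.1) = b.1 := by rw [← add_assoc, h, h']
    refine ⟨⟨y.1 + z.1, y.2.1.add z.2.1, ?_⟩, rfl, key⟩
    have e : 1 - (y.1 + z.1) = (1 - b.1) + x.1 := by rw [← key]; abel
    rw [e]
    exact b.2.2.add x.2.1
  zero_osum x := zero_add x.1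
  osum_compl x := add_sub_cancel x.1 1
  eq_compl h := Subtype.ext (eq_sub_of_add_eq' h)
  eq_zero_of_one_osum := by
    intro x z h
    refine Subtype.ext (x.2.1.eq_zero ?_)
    have e : -x.1 = 1 - z.1 := by rw [← h]; abel
    rw [e]
    exact z.2.2
  smul r a := ⟨((r : ℝ) : ℂ) • a.1, a.2.1.smul r.2.1, by
    have e : 1 - ((r : ℝ) : ℂ) • a.1
        = (1 - a.1) + ((1 - (r : ℝ) : ℝ) : ℂ) • a.1 := by
      rw [Complex.ofReal_sub, sub_smul, Complex.ofReal_one, one_smul]; abel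
    rw [e]
    exact a.2.2.add (a.2.1.smul (sub_nonneg.2 r.2.2))⟩
  one_smul a := Subtype.ext (by simp)
  mul_smul r s a := Subtype.ext (by simp [mul_smul])
  smul_osum r a b c h := by
    change _ • a.1 + _ • b.1 = _ • c.1
    rw [← smul_add, ← h]
  add_smul := by
    intro r s t a h
    change _ • a.1 + _ • a.1 = _ • a.1
    rw [← add_smul, ← Complex.ofReal_add, h]

/-- The restriction of a PU map to effects. -/
def PUMap.onEffect {A : Type u} {B : Type v} [CStarAlgebra A] [CStarAlgebra B] (f : PUMap A B) :
    EModHom (Effect A) (Effect B) where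
  toFun a := ⟨f a.1, f.isPos a.2.1, by simpa using f.isPos a.2.2⟩
  map_osum h := by
    change f _ + f _ = f _
    rw [← map_add, h]
  map_one := Subtype.ext f.apply_one
  map_smul r x := Subtype.ext (map_smul f _ x.1)

/-! ### States -/

/-- The states of `A`: the PU maps `A → ℂ`. -/
abbrev Stat (A : Type u) [CStarAlgebra A] : Type u := PUMap A ℂ

theorem isPos_complex {z : ℂ} : IsPos z ↔ 0 ≤ z.re ∧ z.im = 0 := by
  constructor
  · rintro ⟨y, rfl⟩
    rw [Complex.star_def, ← Complex.normSq_eq_conj_mul_self]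
    exact ⟨by simpa using Complex.normSq_nonneg y, by simp⟩
  · rintro ⟨h, h'⟩
    have e : z = ((z.re : ℝ) : ℂ) • (1 : ℂ) := by
      apply Complex.ext <;> simp [h']
    rw [e]
    exact isPos_one.smul h

namespace Stat

variable {A : Type u} {B : Type v} [CStarAlgebra A] [CStarAlgebra B]

/-- The value `s a ∈ [0,1]` of a state `s` at an effect `a`. -/
def prob (s : Stat A) (a : Effect A) : unitInterval :=
  ⟨(s a.1).re, (isPos_complex.1 (s.isPos a.2.1)).1, by
    have h := (isPos_complex.1 (s.isPos a.2.2)).1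
    rw [map_sub, PUMap.apply_one] at h
    simpa using h⟩

theorem prob_coe (s : Stat A) (a : Effect A) : (((s.prob a : unitInterval) : ℝ) : ℂ) = s a.1 := by
  apply Complex.ext
  · rfl
  · simp [(isPos_complex.1 (s.isPos a.2.1)).2]

/-- The weak-⋆ topology. -/
instance : TopologicalSpace (Stat A) :=
  TopologicalSpace.induced (fun s (a : A) => s a) inferInstance

theorem isInducing_coe : Topology.IsInducing (fun (s : Stat A) (a : A) => s a) := ⟨rfl⟩

theorem isEmbedding_coe : Topology.IsEmbedding (fun (s : Stat A) (a : A) => s a) :=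
  ⟨isInducing_coe, DFunLike.coe_injective⟩

theorem continuous_eval (a : A) : Continuous (fun s : Stat A => s a) :=
  (continuous_apply a).comp isInducing_coe.continuous

theorem continuous_iff {X : Type w} [TopologicalSpace X] {f : X → Stat A} :
    Continuous f ↔ ∀ a, Continuous fun x => f x a := by
  rw [isInducing_coe.continuous_iff, continuous_pi_iff]
  rfl

instance : T2Space (Stat A) := isEmbedding_coe.t2Space

theorem exists_bound (a : A) : ∃ C : ℝ, ∀ s : Stat A, ‖s a‖ ≤ C := by
  have key : ∀ b : A, IsSelfAdjoint b → ∀ s : Stat A, ‖s b‖ ≤ ‖b‖ := by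
    intro b hb s
    let := CStarAlgebra.spectralOrder A
    let := CStarAlgebra.spectralOrderedRing A
    have h1 : IsPos (((‖b‖ : ℝ) : ℂ) • (1 : A) - b) := by
      have h := sub_nonneg.2 hb.le_algebraMap_norm_self
      rw [CStarAlgebra.nonneg_iff_eq_star_mul_self, Algebra.algebraMap_eq_smul_one] at h
      simpa [IsPos] using h
    have h2 : IsPos (((‖b‖ : ℝ) : ℂ) • (1 : A) + b) := by
      have h := sub_nonneg.2 hb.neg_algebraMap_norm_le_self
      rw [CStarAlgebra.nonneg_iff_eq_star_mul_self, Algebra.algebraMap_eq_smul_one] at h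
      simpa [IsPos, add_comm] using h
    have h1' := isPos_complex.1 (s.isPos h1)
    have h2' := isPos_complex.1 (s.isPos h2)
    rw [map_sub, map_smul, PUMap.apply_one] at h1'
    rw [map_add, map_smul, PUMap.apply_one] at h2'
    simp only [smul_eq_mul, mul_one, Complex.sub_re, Complex.ofReal_re, Complex.sub_im,
      Complex.ofReal_im, Complex.add_re, Complex.add_im] at h1' h2'
    have e : s b = (((s b).re : ℝ) : ℂ) := by
      apply Complex.ext
      · simp
      · simpa using h2'.2
    rw [e, Complex.norm_real, Real.norm_eq_abs, abs_le]
    constructor <;> linarith [h1'.1, h2'.1]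
  refine ⟨‖(realPart a : A)‖ + ‖(imaginaryPart a : A)‖, fun s => ?_⟩
  calc ‖s a‖ = ‖s ((realPart a : A) + Complex.I • (imaginaryPart a : A))‖ := by
        rw [realPart_add_I_smul_imaginaryPart]
    _ ≤ ‖s (realPart a : A)‖ + ‖s (imaginaryPart a : A)‖ := by
        rw [map_add, map_smul]
        refine (norm_add_le _ _).trans ?_
        simp
    _ ≤ _ := add_le_add (key _ (realPart a).2 s) (key _ (imaginaryPart a).2 s)

instance : CompactSpace (Stat A) := by
  choose C hC using exists_bound (A := A)
  have hK : IsCompact (Set.pi Set.univ fun a : A => Metric.closedBall (0 : ℂ) (C a)) :=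
    isCompact_univ_pi fun a => isCompact_closedBall _ _
  have hrange : IsClosed (Set.range fun (s : Stat A) (a : A) => s a) := by
    have e : (Set.range fun (s : Stat A) (a : A) => s a) =
        {f | ∀ a b, f (a + b) = f a + f b} ∩ {f | ∀ (c : ℂ) a, f (c • a) = c * f a} ∩
        ({f | ∀ a, IsPos a → 0 ≤ (f a).re ∧ (f a).im = 0} ∩ {f : A → ℂ | f 1 = 1}) := by
      ext f
      constructor
      · rintro ⟨s, rfl⟩
        exact ⟨⟨fun a b => map_add s a b, fun c a => map_smul s c a⟩,
          fun a ha => isPos_complex.1 (s.isPos ha), s.apply_one⟩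
      · rintro ⟨⟨h1, h2⟩, h3, h4⟩
        exact ⟨⟨⟨⟨f, h1⟩, h2⟩, fun a ha => isPos_complex.2 (h3 a ha), h4⟩, rfl⟩
    rw [e]
    have c : ∀ a : A, Continuous fun f : A → ℂ => f a := fun a => continuous_apply a
    refine IsClosed.inter (IsClosed.inter ?_ ?_) (IsClosed.inter ?_ ?_)
    · simp only [Set.ofPred_forall]
      exact isClosed_iInter fun a => isClosed_iInter fun b =>
        isClosed_eq (c _) ((c _).add (c _))
    · simp only [Set.ofPred_forall]
      exact isClosed_iInter fun r => isClosed_iInter fun a =>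
        isClosed_eq (c _) (continuous_const.mul (c _))
    · simp only [Set.ofPred_forall, Set.ofPred_and]
      exact isClosed_iInter fun a => isClosed_iInter fun _ =>
        (isClosed_le continuous_const (Complex.continuous_re.comp (c a))).inter
          (isClosed_eq (Complex.continuous_im.comp (c a)) continuous_const)
    · exact isClosed_eq (c _) continuous_const
  rw [← isCompact_univ_iff, isInducing_coe.isCompact_iff, Set.image_univ]
  refine hK.of_isClosed_subset hrange ?_
  rintro _ ⟨s, rfl⟩ a _
  simpa using hC a s


/-- Precomposition with a PU map. -/
def map (f : PUMap A B) (s : Stat B) : Stat A := s.comp f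

@[simp] theorem map_apply (f : PUMap A B) (s : Stat B) (a : A) : map f s a = s (f a) := rfl

theorem continuous_map (f : PUMap A B) : Continuous (map f) :=
  continuous_iff.2 fun a => continuous_eval (f a)

theorem continuous_prob (a : Effect A) : Continuous fun s : Stat A => s.prob a :=
  (Complex.continuous_re.comp (continuous_eval a.1)).subtype_mk _

end Stat

/-! ### The Radon monad -/

section Continuous

variable {X : Type u} {Y : Type v} [TopologicalSpace X] [CompactSpace X]
  [TopologicalSpace Y] [CompactSpace Y]

theorem isPos_continuousMap {f : C(X, ℂ)} (h : ∀ x, IsPos (f x)) : IsPos f := by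
  refine ⟨⟨fun x => ((Real.sqrt (f x).re : ℝ) : ℂ), by fun_prop⟩, ?_⟩
  ext x
  obtain ⟨h0, h1⟩ := isPos_complex.1 (h x)
  rw [ContinuousMap.mul_apply, ContinuousMap.star_apply]
  change f x = star ((Real.sqrt (f x).re : ℝ) : ℂ) * ((Real.sqrt (f x).re : ℝ) : ℂ)
  rw [Complex.star_def, Complex.conj_ofReal, ← Complex.ofReal_mul, Real.mul_self_sqrt h0]
  apply Complex.ext <;> simp [h1]

theorem IsPos.apply {f : C(X, ℂ)} (h : IsPos f) (x : X) : IsPos (f x) := by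
  obtain ⟨y, rfl⟩ := h
  exact ⟨y x, rfl⟩

/-- A continuous function `X → [0,1]`, as an effect of `C(X, ℂ)`. -/
def toEffect (p : C(X, unitInterval)) : Effect C(X, ℂ) :=
  ⟨⟨fun x => ((p x : ℝ) : ℂ), by fun_prop⟩,
    isPos_continuousMap fun x => isPos_complex.2 ⟨(p x).2.1, Complex.ofReal_im _⟩,
    isPos_continuousMap fun x => isPos_complex.2 (by
      change 0 ≤ (1 - ((p x : ℝ) : ℂ)).re ∧ (1 - ((p x : ℝ) : ℂ)).im = 0
      have := (p x).2.2
      simpa using this)⟩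

@[simp] theorem toEffect_apply (p : C(X, unitInterval)) (x : X) :
    (toEffect p).1 x = ((p x : ℝ) : ℂ) := rfl

/-- For a continuous `g : X → Y`, the map `C(Y, ℂ) → C(X, ℂ)`, `v ↦ v ∘ g`. -/
def pullback (g : C(X, Y)) : PUMap C(Y, ℂ) C(X, ℂ) where
  toLinearMap :=
    { toFun := fun v => v.comp g
      map_add' := fun _ _ => rfl
      map_smul' := fun _ _ => rfl }
  map_isPos _ h := isPos_continuousMap fun x => h.apply (g x)
  map_one := rfl

@[simp] theorem pullback_apply (g : C(X, Y)) (v : C(Y, ℂ)) : pullback g v = v.comp g := rfl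

/-- The Dirac state at a point. -/
def dirac (x : X) : Stat C(X, ℂ) where
  toLinearMap :=
    { toFun := fun v => v x
      map_add' := fun _ _ => rfl
      map_smul' := fun _ _ => rfl }
  map_isPos _ h := h.apply x
  map_one := rfl

@[simp] theorem dirac_apply (x : X) (v : C(X, ℂ)) : dirac x v = v x := rfl

theorem continuous_dirac : Continuous (dirac : X → Stat C(X, ℂ)) :=
  Stat.continuous_iff.2 fun v => v.continuous

end Continuous

/-- The evaluation map `a ↦ (s ↦ s a)` from `A` to the continuous functions on its states. -/
def evStat (A : Type u) [CStarAlgebra A] : PUMap A C(Stat A, ℂ) where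
  toLinearMap :=
    { toFun := fun a => ⟨fun s => s a, Stat.continuous_eval a⟩
      map_add' := fun a b => ContinuousMap.ext fun s => map_add s a b
      map_smul' := fun c a => ContinuousMap.ext fun s => map_smul s c a }
  map_isPos _ h := isPos_continuousMap fun s => s.isPos h
  map_one := ContinuousMap.ext fun s => s.apply_one

@[simp] theorem evStat_apply (A : Type u) [CStarAlgebra A] (a : A) (s : Stat A) :
    evStat A a s = s a := rfl

/-- For `ν ∈ Stat (C(Stat A, ℂ))`, the state `a ↦ ν (s ↦ s a)` of `A`. It is the only possible
barycentre of `ν`, since the functions `s ↦ s a` are continuous, affine, and separate states. -/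
def barycentre (A : Type u) [CStarAlgebra A] : Stat C(Stat A, ℂ) → Stat A := Stat.map (evStat A)

@[simp] theorem barycentre_apply (A : Type u) [CStarAlgebra A] (ν : Stat C(Stat A, ℂ)) (a : A) :
    barycentre A ν a = ν (evStat A a) := rfl

/-- The Radon monad on compact Hausdorff spaces: `R X = Stat (C(X, ℂ))` with the weak-⋆ topology,
`R g ν v = ν (v ∘ g)`, `η x v = v x`, `μ g v = g (h ↦ h v)`. -/
def radon : Monad CompHaus.{u} where
  obj X := CompHaus.of (Stat C(X, ℂ))
  map g := CompHausLike.ofHom _ ⟨Stat.map (pullback g.hom.hom), Stat.continuous_map _⟩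
  map_id X := by ext ν; rfl
  map_comp f g := by ext ν; rfl
  η :=
    { app := fun X => CompHausLike.ofHom _ ⟨dirac, continuous_dirac⟩
      naturality := fun X Y f => by ext x; rfl }
  μ :=
    { app := fun X => CompHausLike.ofHom _ ⟨barycentre C(X, ℂ), Stat.continuous_map _⟩
      naturality := fun X Y f => by ext x; rfl }
  assoc X := by ext x; rfl
  left_unit X := by ext x; rfl
  right_unit X := by ext x; rfl

/-! ### Homming into `[0,1]` -/

section EModDual

variable (M : Type u) [EffectModule M]

/-- `EMod(M,[0,1])`. -/
abbrev EModDual : Type u := EModHom M unitInterval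

/-- The topology of pointwise convergence. -/
instance : TopologicalSpace (EModDual M) :=
  TopologicalSpace.induced (fun f (x : M) => f x) inferInstance

theorem EModDual.isEmbedding_coe :
    Topology.IsEmbedding (fun (f : EModDual M) (x : M) => f x) :=
  ⟨⟨rfl⟩, DFunLike.coe_injective⟩

variable {M}

theorem EModDual.continuous_eval (x : M) : Continuous fun f : EModDual M => f x :=
  (continuous_apply x).comp (EModDual.isEmbedding_coe M).continuous

theorem EModDual.continuous_iff {X : Type w} [TopologicalSpace X] {g : X → EModDual M} :
    Continuous g ↔ ∀ m, Continuous fun x => g x m := by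
  rw [(EModDual.isEmbedding_coe M).isInducing.continuous_iff, continuous_pi_iff]
  rfl

instance : T2Space (EModDual M) := (EModDual.isEmbedding_coe M).t2Space

instance : CompactSpace (EModDual M) := by
  have hrange : IsClosed (Set.range fun (f : EModDual M) (x : M) => f x) := by
    have e : (Set.range fun (f : EModDual M) (x : M) => f x) =
        {f | ∀ x y z : M, EffectAlgebra.osum x y z → (f x : ℝ) + f y = f z} ∩
        ({f | f EffectAlgebra.one = 1} ∩
          {f | ∀ (r : unitInterval) (x : M), f (EffectModule.smul r x) = r * f x}) := by
      ext f
      constructor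
      · rintro ⟨s, rfl⟩
        exact ⟨fun x y z h => s.map_osum h, s.map_one, s.map_smul⟩
      · rintro ⟨h1, h2, h3⟩
        exact ⟨⟨f, fun {x y z} h => h1 x y z h, h2, h3⟩, rfl⟩
    rw [e]
    have c : ∀ x : M, Continuous fun f : M → unitInterval => f x := fun x => continuous_apply x
    refine IsClosed.inter ?_ (IsClosed.inter ?_ ?_)
    · simp only [Set.ofPred_forall]
      exact isClosed_iInter fun x => isClosed_iInter fun y => isClosed_iInter fun z =>
        isClosed_iInter fun _ => isClosed_eq
          ((continuous_subtype_val.comp (c x)).add (continuous_subtype_val.comp (c y)))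
          (continuous_subtype_val.comp (c z))
    · exact isClosed_eq (c _) continuous_const
    · simp only [Set.ofPred_forall]
      exact isClosed_iInter fun r => isClosed_iInter fun x =>
        isClosed_eq (c _) (continuous_const.mul (c _))
  rw [← isCompact_univ_iff, (EModDual.isEmbedding_coe M).isInducing.isCompact_iff,
    Set.image_univ]
  exact hrange.isCompact

/-- Evaluation at `x`, as a continuous function on `EMod(M,[0,1])`. -/
def evDual (x : M) : C(EModDual M, unitInterval) := ⟨fun f => f x, EModDual.continuous_eval x⟩

@[simp] theorem evDual_apply (x : M) (f : EModDual M) : evDual x f = f x := rfl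

end EModDual

theorem Stat.prob_eq_of_apply_eq {A : Type u} {B : Type v} [CStarAlgebra A] [CStarAlgebra B]
    {s : Stat A} {t : Stat B} {a : Effect A} {b : Effect B} (h : s a.1 = t b.1) :
    s.prob a = t.prob b :=
  Subtype.ext (congrArg Complex.re h)

/-- The map of effect modules `p ↦ ∫ p dν` from `Cont(X,[0,1])` to `[0,1]`, for `ν` in `R X`;
`Stat.prob ν (toEffect p)` is the number `ν p`. -/
def mean {X : Type u} [TopologicalSpace X] [CompactSpace X] (ν : Stat C(X, ℂ)) :
    EModDual C(X, unitInterval) where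
  toFun p := ν.prob (toEffect p)
  map_osum := by
    intro p q r h
    have e : (toEffect p).1 + (toEffect q).1 = (toEffect r).1 := by
      ext x
      change ((p x : ℝ) : ℂ) + ((q x : ℝ) : ℂ) = ((r x : ℝ) : ℂ)
      rw [← h x, Complex.ofReal_add]
    change (ν (toEffect p).1).re + (ν (toEffect q).1).re = (ν (toEffect r).1).re
    rw [← e, map_add, Complex.add_re]
  map_one := by
    have e : (toEffect (EffectAlgebra.one : C(X, unitInterval))).1 = 1 := by
      ext x
      change (((1 : unitInterval) : ℝ) : ℂ) = 1
      simp
    apply Subtype.ext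
    change (ν _).re = 1
    rw [e, PUMap.apply_one, Complex.one_re]
  map_smul := by
    intro r p
    have e : (toEffect (EffectModule.smul r p)).1 = ((r : ℝ) : ℂ) • (toEffect p).1 := by
      ext x
      change (((r * p x : unitInterval) : ℝ) : ℂ) = ((r : ℝ) : ℂ) * ((p x : ℝ) : ℂ)
      simp
    apply Subtype.ext
    change (ν _).re = (r : ℝ) * (ν (toEffect p).1).re
    rw [e, map_smul, smul_eq_mul, Complex.re_ofReal_mul]

theorem mean_coe {X : Type u} [TopologicalSpace X] [CompactSpace X] (ν : Stat C(X, ℂ))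
    (p : C(X, unitInterval)) : (((mean ν p : unitInterval) : ℝ) : ℂ) = ν (toEffect p).1 :=
  Stat.prob_coe ν (toEffect p)

theorem continuous_mean {X : Type u} [TopologicalSpace X] [CompactSpace X]
    (p : C(X, unitInterval)) : Continuous fun ν : Stat C(X, ℂ) => mean ν p :=
  Stat.continuous_prob (toEffect p)

/-- The structure map `R(EMod(M,[0,1])) → EMod(M,[0,1])`, `h ↦ (x ↦ h(ev_x))`. -/
def dualStructure (M : Type u) [EffectModule M] (h : Stat C(EModDual M, ℂ)) : EModDual M where
  toFun x := mean h (evDual x)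
  map_osum hs := (mean h).map_osum fun f => f.map_osum hs
  map_one := by
    have e : evDual (EffectAlgebra.one : M) = EffectAlgebra.one :=
      ContinuousMap.ext fun f => f.map_one
    rw [e]
    exact (mean h).map_one
  map_smul r x := by
    have e : evDual (EffectModule.smul r x) = EffectModule.smul r (evDual x) :=
      ContinuousMap.ext fun f => f.map_smul r x
    rw [e]
    exact (mean h).map_smul r _

theorem dualStructure_apply (M : Type u) [EffectModule M] (h : Stat C(EModDual M, ℂ)) (x : M) :
    dualStructure M h x = mean h (evDual x) := rfl

/-- `EMod(M,[0,1])` as an Eilenberg–Moore algebra of the Radon monad. -/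
def dualAlgebra (M : Type u) [EffectModule M] : radon.{u}.Algebra where
  A := CompHaus.of (EModDual M)
  a := CompHausLike.ofHom _ ⟨dualStructure M,
    EModDual.continuous_iff.2 fun x => continuous_mean (evDual x)⟩
  unit := by
    ext f x
    rfl
  assoc := by
    ext Φ x
    refine congrArg Subtype.val (Stat.prob_eq_of_apply_eq ?_)
    let Ψ : Stat C(Stat C(EModDual M, ℂ), ℂ) := Φ
    change Ψ (evStat _ (toEffect (evDual x)).1) = Ψ _
    refine congrArg Ψ (ContinuousMap.ext fun ν => ?_)
    exact (mean_coe ν (evDual x)).symm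

/-- The functor `EMod(-,[0,1])` from `EModᵒᵖ` to the category `EM(R)` of Eilenberg–Moore
algebras of the Radon monad. -/
def emodHom : EModCat.{u}ᵒᵖ ⥤ radon.{u}.Algebra where
  obj M := dualAlgebra M.unop.carrier
  map {M N} g :=
    { f := CompHausLike.ofHom _
        ⟨fun (f : EModDual M.unop.carrier) => (EModHom.comp f g.unop : EModDual N.unop.carrier),
          EModDual.continuous_iff.2 fun x => EModDual.continuous_eval (g.unop.toFun x)⟩
      h := by ext ν; rfl }
  map_id M := by ext f; rfl
  map_comp g h := by ext f; rfl

/-- The state `v ↦ ∑ i, w i * v (x i)` given by a formal convex sum of points. -/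
def convexState {X : Type u} [TopologicalSpace X] [CompactSpace X] {n : ℕ}
    (w : stdSimplex ℝ (Fin n)) (x : Fin n → X) : Stat C(X, ℂ) where
  toLinearMap :=
    { toFun := fun v => ∑ i, ((w.1 i : ℝ) : ℂ) * v (x i)
      map_add' := fun a b => by
        simp [mul_add, Finset.sum_add_distrib]
      map_smul' := fun c a => by
        simp only [ContinuousMap.smul_apply, smul_eq_mul, RingHom.id_apply, Finset.mul_sum]
        exact Finset.sum_congr rfl fun i _ => by ring }
  map_isPos v h := by
    refine isPos_complex.2 ⟨?_, ?_⟩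
    · simp only [LinearMap.coe_mk, AddHom.coe_mk, Complex.re_sum, Complex.re_ofReal_mul]
      exact Finset.sum_nonneg fun i _ =>
        mul_nonneg (w.2.1 i) (isPos_complex.1 (h.apply (x i))).1
    · simp only [LinearMap.coe_mk, AddHom.coe_mk, Complex.im_sum, Complex.im_ofReal_mul]
      exact Finset.sum_eq_zero fun i _ => by
        rw [(isPos_complex.1 (h.apply (x i))).2, mul_zero]
  map_one := by
    simp only [LinearMap.coe_mk, AddHom.coe_mk, ContinuousMap.one_apply, mul_one]
    rw [← Complex.ofReal_sum, w.2.2, Complex.ofReal_one]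

@[simp] theorem convexState_apply {X : Type u} [TopologicalSpace X] [CompactSpace X] {n : ℕ}
    (w : stdSimplex ℝ (Fin n)) (x : Fin n → X) (v : C(X, ℂ)) :
    convexState w x v = ∑ i, ((w.1 i : ℝ) : ℂ) * v (x i) := rfl

/-- The structure map of an algebra of the Radon monad, as a function. -/
def str (X : radon.{u}.Algebra) (ν : Stat C(X.A, ℂ)) : X.A := X.a ν

/-- The convex sum `∑ i, w i x i` in an algebra of the Radon monad. -/
def convexSum (X : radon.{u}.Algebra) {n : ℕ} (w : stdSimplex ℝ (Fin n)) (x : Fin n → X.A) :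
    X.A :=
  str X (convexState w x)

theorem map_convexSum {X Y : radon.{u}.Algebra} (g : X ⟶ Y) {n : ℕ}
    (w : stdSimplex ℝ (Fin n)) (x : Fin n → X.A) :
    g.f (convexSum X w x) = convexSum Y w fun i => g.f (x i) :=
  (ConcreteCategory.congr_hom g.h (convexState w x)).symm

/-- `𝒜(X,[0,1])`: the continuous affine functions from an algebra of the Radon monad
to `[0,1]`; affine functions are those that preserve convex sums. -/
@[ext]
structure AffMap (X : radon.{u}.Algebra) where
  toFun : X.A → unitInterval
  continuous_toFun : Continuous toFun
  affine : ∀ {n : ℕ} (w : stdSimplex ℝ (Fin n)) (x : Fin n → X.A),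
    (toFun (convexSum X w x) : ℝ) = ∑ i, w.1 i * toFun (x i)

namespace AffMap

variable {X : radon.{u}.Algebra}

instance : FunLike (AffMap X) X.A unitInterval where
  coe := AffMap.toFun
  coe_injective _ _ h := AffMap.ext h

/-- `𝒜(X,[0,1])` is an effect module with pointwise operations. -/
instance : EffectModule (AffMap X) where
  zero := ⟨fun _ => 0, continuous_const, fun w x => by simp⟩
  one := ⟨fun _ => 1, continuous_const, fun w x => by
    simp only [Set.Icc.coe_one, mul_one]
    exact w.2.2.symm⟩
  compl f := ⟨fun x => unitInterval.symm (f x), by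
    have := f.continuous_toFun
    change Continuous fun x => unitInterval.symm (f.toFun x)
    fun_prop, fun w x => by
    have h := f.affine w x
    change 1 - (f.toFun _ : ℝ) = ∑ i, w.1 i * (1 - (f.toFun (x i) : ℝ))
    rw [h]
    simp only [mul_sub, mul_one, Finset.sum_sub_distrib]
    rw [w.2.2]⟩
  osum f g h := ∀ x, (f x : ℝ) + g x = h x
  osum_unique h h' := DFunLike.ext _ _ fun x => EffectAlgebra.osum_unique (h x) (h' x)
  osum_comm h x := (add_comm _ _).trans (h x)
  osum_assoc := by
    intro p q r a b h h'
    have key : ∀ x, (p x : ℝ) + (q x + r x) = b x := fun x => by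
      have := h x; have := h' x; linarith
    refine ⟨⟨fun x => ⟨(q x : ℝ) + r x, add_nonneg (q x).2.1 (r x).2.1, ?_⟩, ?_, ?_⟩,
      fun x => rfl, key⟩
    · have := (p x).2.1; have := (b x).2.2; have := key x; linarith
    · exact ((continuous_subtype_val.comp q.continuous_toFun).add
        (continuous_subtype_val.comp r.continuous_toFun)).subtype_mk _
    · intro n w x
      change (q.toFun _ : ℝ) + r.toFun _ = ∑ i, w.1 i * ((q.toFun (x i) : ℝ) + r.toFun (x i))
      rw [q.affine, r.affine]
      simp only [mul_add, Finset.sum_add_distrib]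
  zero_osum p x := EffectAlgebra.zero_osum (p x)
  osum_compl p x := EffectAlgebra.osum_compl (p x)
  eq_compl h := DFunLike.ext _ _ fun x => EffectAlgebra.eq_compl (h x)
  eq_zero_of_one_osum h := DFunLike.ext _ _ fun x => EffectAlgebra.eq_zero_of_one_osum (h x)
  smul r f := ⟨fun x => r * f x, continuous_const.mul f.continuous_toFun, fun w x => by
    have h := f.affine w x
    change (r : ℝ) * (f.toFun _ : ℝ) = ∑ i, w.1 i * ((r : ℝ) * (f.toFun (x i) : ℝ))
    rw [h, Finset.mul_sum]
    exact Finset.sum_congr rfl fun i _ => by ring⟩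
  one_smul p := DFunLike.ext _ _ fun x => one_mul (p x)
  mul_smul r s p := DFunLike.ext _ _ fun x => mul_assoc r s (p x)
  smul_osum r p q s h x := EffectModule.smul_osum (x := p x) (y := q x) (z := s x) r (h x)
  add_smul p h x := EffectModule.add_smul (p x) h

/-- Precomposition with a map of algebras. -/
def precomp {Y : radon.{u}.Algebra} (g : X ⟶ Y) : EModHom (AffMap Y) (AffMap X) where
  toFun f := ⟨fun x => f (g.f x), f.continuous_toFun.comp (g.f.hom.hom.continuous), fun w x => by
    rw [map_convexSum]
    exact f.affine w _⟩
  map_osum h x := h (g.f x)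
  map_one := rfl
  map_smul _ _ := rfl

end AffMap

/-- The functor `𝒜(-,[0,1])` from `EM(R)` to `EModᵒᵖ`. -/
def affHom : radon.{u}.Algebra ⥤ EModCat.{u}ᵒᵖ where
  obj X := Opposite.op ⟨AffMap X⟩
  map g := Quiver.Hom.op (AffMap.precomp g : EModHom _ _)
  map_id _ := rfl
  map_comp _ _ := rfl

/-! ### Predicate and state functors -/

/-- The map of effect modules `Cont(Y,[0,1]) → Cont(X,[0,1])`, `p ↦ (x ↦ ∫ p d(f x))`, for
a continuous `f : X → R Y`. -/
def predMap {X Y : Type u} [TopologicalSpace X] [TopologicalSpace Y] [CompactSpace Y]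
    (f : C(X, Stat C(Y, ℂ))) : EModHom C(Y, unitInterval) C(X, unitInterval) where
  toFun p := ⟨fun x => mean (f x) p, (continuous_mean p).comp f.continuous⟩
  map_osum h x := (mean (f x)).map_osum h
  map_one := ContinuousMap.ext fun x => (mean (f x)).map_one
  map_smul r p := ContinuousMap.ext fun x => (mean (f x)).map_smul r p

/-- The predicate functor `Cont(-,[0,1]) : Kl(R) → EModᵒᵖ`. -/
def klPred : Kleisli radon.{u} ⥤ EModCat.{u}ᵒᵖ where
  obj X := Opposite.op ⟨C(X.of, unitInterval)⟩
  map {X Y} f := Quiver.Hom.op (predMap (X := X.of) (Y := Y.of) f.of.hom.hom : EModHom _ _)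
  map_id X := by
    apply Quiver.Hom.unop_inj
    refine EModHom.ext (funext fun p => ContinuousMap.ext fun x => ?_)
    exact Subtype.ext rfl
  map_comp {X Y Z} f g := by
    apply Quiver.Hom.unop_inj
    refine EModHom.ext (funext fun p => ContinuousMap.ext fun x => ?_)
    refine Stat.prob_eq_of_apply_eq ?_
    let ν : Stat C(Y.of, ℂ) := f.of.hom.hom x
    refine congrArg ν (ContinuousMap.ext fun y => ?_)
    exact (mean_coe (g.of.hom.hom y : Stat C(Z.of, ℂ)) p).symm

/-- The state functor `Kl(R) → EM(R)`: the comparison functor, which sends `X` to the free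
algebra `(R X, μ)` and `f : X → R Y` to `μ ∘ R f`. -/
def klStat : Kleisli radon.{u} ⥤ radon.{u}.Algebra where
  obj X := radon.free.obj X.of
  map {X Y} f :=
    { f := radon.map f.of ≫ radon.μ.app Y.of
      h := by ext ν; rfl }
  map_id X := by ext ν; rfl
  map_comp f g := by ext ν; rfl

/-- The predicate functor `A ↦ [0,1]_A`, from the opposite of the category of C⋆-algebras and
PU maps to `EModᵒᵖ`. -/
def cstarPred : CStarPU.{u}ᵒᵖ ⥤ EModCat.{u}ᵒᵖ :=
  Functor.op
    { obj := fun A => ⟨Effect A.carrier⟩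
      map := fun f => PUMap.onEffect f
      map_id := fun _ => rfl
      map_comp := fun _ _ => rfl }

/-- The state space of a C⋆-algebra as an Eilenberg–Moore algebra of the Radon monad;
the structure map sends `ν` to its barycentre. -/
def statAlgebra (A : Type u) [CStarAlgebra A] : radon.{u}.Algebra where
  A := CompHaus.of (Stat A)
  a := CompHausLike.ofHom _ ⟨barycentre A, Stat.continuous_map _⟩
  unit := by ext s; rfl
  assoc := by ext Φ; rfl

/-- The state functor from the opposite of the category of C⋆-algebras and PU maps to `EM(R)`. -/
def cstarStat : CStarPU.{u}ᵒᵖ ⥤ radon.{u}.Algebra where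
  obj A := statAlgebra A.unop.carrier
  map {A B} f :=
    { f := CompHausLike.ofHom _
        ⟨(Stat.map f.unop : Stat A.unop.carrier → Stat B.unop.carrier), Stat.continuous_map _⟩
      h := by ext ν; rfl }
  map_id A := by ext s; rfl
  map_comp f g := by ext s; rfl

/-! ### Reading off values -/

/-- The function underlying a map of effect modules. -/
def emodApply {M N : EModCat.{u}} (f : M ⟶ N) (m : M.carrier) : N.carrier :=
  EModHom.toFun f m

/-- The value at `m` of an element of `EMod(M,[0,1])`. -/
def dualEval {M : EModCat.{u}ᵒᵖ} (f : (emodHom.obj M).A) (m : M.unop.carrier) : unitInterval :=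
  EModHom.toFun (f : EModDual M.unop.carrier) m

/-- The value at `x` of an element of `𝒜(X,[0,1])`. -/
def affEval {X : radon.{u}.Algebra} (f : (affHom.obj X).unop.carrier) (x : X.A) : unitInterval :=
  AffMap.toFun (f : AffMap X) x

end StateEffect

end

open Opposite StateEffect

noncomputable section

/-! Three facts carry the proof.

Effects generate the self-adjoint part: every self-adjoint `a` has the form `2r • x - r • 1` with
`x` an effect. A map of effect modules from the effects of `A` to `[0,1]` respects every relation
between nonnegative combinations of effects (`combination_congr`), because dividing by a large
scalar turns the relation into one inside the effect module. It therefore extends uniquely to a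
positive unital real functional, and then to a state. This identifies `Stat(A)` with the dual of the
effects; taking `A = C(X, ℂ)`, whose effects are the continuous functions into `[0,1]`, it also
identifies `R(X)` with the dual of `Cont(X,[0,1])`.

Finite convex combinations of Dirac states are weak-⋆ dense in `R(X)` (`exists_convexState_near`). A
continuous function `f` on an algebra `(X, α)` that preserves finite convex sums hence satisfies
`f(α(ν)) = ∫ f dν` for every `ν` (`AffMap.apply_str`). This says precisely that the transpose of a
map `M → 𝒜(X,[0,1])` is a morphism of algebras, which gives the adjunction. On the free algebra,
where `ν = μ(R(η)(ν))`, it yields `f(ν) = ∫ f(δ_x) dν(x)`, so `f` comes from a unique function on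
`X`.

Kadison's representation theorem settles the effects of a C⋆-algebra. States detect positivity and
the norm of self-adjoint elements, by Hahn–Banach separation from the positive cone, so `a ↦ (s ↦ s
a)` is injective and reflects sums. For surjectivity, two states on `C(Stat A, ℂ)` that agree on all
evaluations have the same barycentre, hence agree at each continuous affine `f`. A second separation
argument (`exists_mem_near_of_states`) then makes `f` a uniform limit of evaluations at self-adjoint
elements. These elements form a Cauchy sequence, and their limit represents `f`. -/

namespace StateEffect


/-! ### The order and the norm of self-adjoint elements -/

section Order

variable {A : Type u} [CStarAlgebra A]

theorem IsPos.isSelfAdjoint {a : A} (ha : IsPos a) : IsSelfAdjoint a := by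
  obtain ⟨y, rfl⟩ := ha
  exact IsSelfAdjoint.star_mul_self y

theorem isPos_norm_sub {a : A} (ha : IsSelfAdjoint a) : IsPos (((‖a‖ : ℝ) : ℂ) • (1 : A) - a) := by
  let := CStarAlgebra.spectralOrder A
  let := CStarAlgebra.spectralOrderedRing A
  have h := sub_nonneg.2 ha.le_algebraMap_norm_self
  rw [CStarAlgebra.nonneg_iff_eq_star_mul_self, Algebra.algebraMap_eq_smul_one] at h
  simpa [IsPos] using h

theorem isPos_norm_add {a : A} (ha : IsSelfAdjoint a) : IsPos (((‖a‖ : ℝ) : ℂ) • (1 : A) + a) := by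
  simpa using isPos_norm_sub ha.neg

theorem isPos_smul_one {r : ℝ} (hr : 0 ≤ r) : IsPos ((r : ℂ) • (1 : A)) := isPos_one.smul hr

/-- The positive cone is closed, and `a` is the limit of `a + δ • 1` as `δ` decreases to `0`. -/
theorem IsPos.of_forall_pos_add {a : A} (h : ∀ δ : ℝ, 0 < δ → IsPos (a + (δ : ℂ) • (1 : A))) :
    IsPos a := by
  let := CStarAlgebra.spectralOrder A
  let := CStarAlgebra.spectralOrderedRing A
  have key : ∀ b : A, IsPos b ↔ 0 ≤ b := fun b => CStarAlgebra.nonneg_iff_eq_star_mul_self.symm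
  simp only [key] at h ⊢
  have c : Continuous fun δ : ℝ => a + (δ : ℂ) • (1 : A) := by fun_prop
  have hc : Filter.Tendsto (fun δ : ℝ => a + (δ : ℂ) • (1 : A)) (nhdsWithin 0 (Set.Ioi 0))
      (nhds a) := by
    have := c.tendsto 0
    simp only [Complex.ofReal_zero, zero_smul, add_zero] at this
    exact this.mono_left nhdsWithin_le_nhds
  exact ge_of_tendsto hc (Filter.eventually_of_mem self_mem_nhdsWithin fun δ hδ => h δ hδ)

/-- The spectrum of `a` lies in `[-r, r]` and contains `‖a‖` or `-‖a‖`. -/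
theorem norm_le_of_isPos {a : A} (ha : IsSelfAdjoint a) {r : ℝ} (hr : 0 ≤ r)
    (h₁ : IsPos ((r : ℂ) • (1 : A) - a)) (h₂ : IsPos ((r : ℂ) • (1 : A) + a)) : ‖a‖ ≤ r := by
  let := CStarAlgebra.spectralOrder A
  let := CStarAlgebra.spectralOrderedRing A
  have key : ∀ b : A, IsPos b ↔ 0 ≤ b := fun b => CStarAlgebra.nonneg_iff_eq_star_mul_self.symm
  have e : (r : ℂ) • (1 : A) = algebraMap ℝ A r := by
    rw [Algebra.algebraMap_eq_smul_one]; simp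
  rw [key, e, sub_nonneg] at h₁
  rw [key, e, ← neg_le_iff_add_nonneg'] at h₂
  rcases subsingleton_or_nontrivial A with _ | _
  · rw [Subsingleton.elim a 0, norm_zero]
    exact hr
  · rcases CStarAlgebra.norm_or_neg_norm_mem_spectrum ha with h | h
    · exact (le_algebraMap_iff_spectrum_le ha).1 h₁ _ h
    · have := (le_algebraMap_iff_spectrum_le ha.neg).1 (neg_le.1 h₂) ‖a‖ (by
        rw [← spectrum.neg_eq]; simpa using h)
      exact this

end Order

/-! ### States determine order and norm -/

namespace Stat

variable {A : Type u} [CStarAlgebra A]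

/-- The positive element `‖a‖ • 1 + a` is sent to a real number, and `s 1 = 1` is real too. -/
theorem im_apply (s : Stat A) {a : A} (ha : IsSelfAdjoint a) : (s a).im = 0 := by
  have h := (isPos_complex.1 (s.isPos (isPos_norm_add ha))).2
  rw [map_add, map_smul, PUMap.apply_one] at h
  simpa using h

theorem coe_re_apply (s : Stat A) {a : A} (ha : IsSelfAdjoint a) : (((s a).re : ℝ) : ℂ) = s a :=
  Complex.ext rfl (s.im_apply ha).symm

theorem abs_re_apply_le (s : Stat A) {a : A} (ha : IsSelfAdjoint a) : |(s a).re| ≤ ‖a‖ := by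
  have h₁ := (isPos_complex.1 (s.isPos (isPos_norm_sub ha))).1
  have h₂ := (isPos_complex.1 (s.isPos (isPos_norm_add ha))).1
  rw [map_sub, map_smul, PUMap.apply_one] at h₁
  rw [map_add, map_smul, PUMap.apply_one] at h₂
  simp at h₁ h₂
  exact abs_le.2 ⟨by linarith, h₁⟩

theorem ext_selfAdjoint {s t : Stat A}
    (h : ∀ a : A, IsSelfAdjoint a → (s a).re = (t a).re) : s = t := by
  have key : ∀ a : A, IsSelfAdjoint a → s a = t a := fun a ha => by
    rw [← s.coe_re_apply ha, ← t.coe_re_apply ha, h a ha]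
  refine PUMap.funext fun a => ?_
  rw [← realPart_add_I_smul_imaginaryPart a, map_add, map_add, map_smul, map_smul,
    key _ (realPart a).2, key _ (imaginaryPart a).2]

/-- The correction term vanishes because the real part of `I • a` is minus the imaginary part of
`a`, which is `0`. -/
theorem extendRCLike_coe (L : selfAdjoint A →ₗ[ℝ] ℝ) (a : selfAdjoint A) :
    (Module.Dual.extendRCLike (L ∘ₗ realPart) : A →ₗ[ℂ] ℂ) (a : A) = ((L a : ℝ) : ℂ) := by
  rw [Module.Dual.extendRCLike_apply]
  change ((L (realPart (a : A)) : ℝ) : ℂ) - Complex.I *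
    ((L (realPart (Complex.I • (a : A))) : ℝ) : ℂ) = _
  rw [realPart_I_smul, a.2.imaginaryPart, selfAdjoint.realPart_coe]
  simp

/-- A positive unital real functional on the self-adjoint part of `A` extends to a state. -/
def ofReal (L : selfAdjoint A →ₗ[ℝ] ℝ)
    (hpos : ∀ a : selfAdjoint A, IsPos (a : A) → 0 ≤ L a) (hone : L 1 = 1) : Stat A where
  toLinearMap := Module.Dual.extendRCLike (L ∘ₗ realPart)
  map_isPos a ha := by
    rw [isPos_complex, show a = ((⟨a, ha.isSelfAdjoint⟩ : selfAdjoint A) : A) from rfl,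
      extendRCLike_coe]
    exact ⟨hpos _ ha, Complex.ofReal_im _⟩
  map_one := by
    rw [show (1 : A) = ((1 : selfAdjoint A) : A) from rfl, extendRCLike_coe, hone,
      Complex.ofReal_one]

theorem ofReal_apply (L : selfAdjoint A →ₗ[ℝ] ℝ)
    (hpos : ∀ a : selfAdjoint A, IsPos (a : A) → 0 ≤ L a) (hone : L 1 = 1) (a : selfAdjoint A) :
    ofReal L hpos hone a = ((L a : ℝ) : ℂ) := extendRCLike_coe L a

-- Hahn–Banach separates a translate of `a` from the interior of the positive cone. The separating
-- functional `f` is nonpositive on the cone with `f 1 < 0`, so `f / f 1` is a state.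
open scoped Pointwise in
theorem exists_re_apply_neg (a : selfAdjoint A) (ha : ¬ IsPos (a : A)) :
    ∃ s : Stat A, (s (a : A)).re < 0 := by
  -- Separating `a` itself would only give `0 ≤ f a`. With `a + δ • 1` in its place, `0 ≤ f a + δ *
  -- f 1` and `f 1 < 0` force `0 < f a`.
  have hδ : ∃ δ : ℝ, 0 < δ ∧ ¬ IsPos ((a : A) + (δ : ℂ) • (1 : A)) := by
    by_contra! h
    exact ha (IsPos.of_forall_pos_add h)
  obtain ⟨δ, hδ, hna⟩ := hδ
  let P : Set (selfAdjoint A) := {b | IsPos (b : A)}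
  have hP : Convex ℝ P := by
    intro x hx y hy r t hr ht _
    have := (IsPos.smul hx hr).add (IsPos.smul hy ht)
    simpa [P] using this
  have hone : (1 : selfAdjoint A) ∈ interior P := by
    -- If `‖b - 1‖ < 1`, then `b = (‖b - 1‖ + (b - 1)) + (1 - ‖b - 1‖)` is a sum of two positive
    -- elements.
    refine mem_interior.2 ⟨Metric.ball 1 1, fun b hb => ?_, Metric.isOpen_ball,
      Metric.mem_ball_self one_pos⟩
    rw [Metric.mem_ball, dist_eq_norm] at hb
    have h1 := isPos_norm_add (b - 1).2
    have h2 : IsPos (((1 - ‖b - 1‖ : ℝ) : ℂ) • (1 : A)) := isPos_smul_one (by linarith)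
    have := h1.add h2
    change IsPos (b : A)
    convert this using 1
    simp [sub_smul]
    abel
  have hsmul : ∀ b ∈ interior P, ∀ t : ℝ, 0 < t → t • b ∈ interior P := by
    intro b hb t ht
    have hsub : t • P ⊆ P := by
      rintro _ ⟨c, hc, rfl⟩
      have := IsPos.smul hc ht.le
      simpa [P] using this
    have := Set.smul_mem_smul_set (a := t) hb
    rw [← interior_smul₀ ht.ne'] at this
    exact interior_mono hsub this
  obtain ⟨f, u, h1, h2⟩ := geometric_hahn_banach_open (hP.interior) isOpen_interior
    (convex_singleton (a + δ • (1 : selfAdjoint A))) (by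
      rw [Set.disjoint_singleton_right]
      intro h
      refine hna ?_
      have := interior_subset h
      simpa [P] using this)
  have h2 := h2 _ rfl
  have hu : 0 ≤ u := by
    by_contra! hu
    have h3 := h1 1 hone
    -- The interior of the cone is closed under positive scaling, and this multiple of `1` has value
    -- `u / 2`, which exceeds a negative `u`.
    have h4 := h1 ((u / (2 * f 1)) • 1) (hsmul _ hone _ (div_pos_of_neg_of_neg hu (by linarith)))
    have h5 : f 1 ≠ 0 := by linarith
    rw [map_smul, smul_eq_mul] at h4
    have : u / (2 * f 1) * f 1 = u / 2 := by field_simp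
    linarith
  have hneg : ∀ b ∈ interior P, f b ≤ 0 := by
    intro b hb
    by_contra! hfb
    have h4 := h1 (((u + 1) / f b) • b) (hsmul _ hb _ (by positivity))
    rw [map_smul, smul_eq_mul, div_mul_cancel₀ _ hfb.ne'] at h4
    linarith
  have hneg' : ∀ b ∈ P, f b ≤ 0 := by
    intro b hb
    have hcl : b ∈ closure (interior P) := by
      rw [hP.closure_interior_eq_closure_of_nonempty_interior ⟨1, hone⟩]
      exact subset_closure hb
    exact closure_minimal hneg (isClosed_le f.continuous continuous_const) hcl
  have hf1 : f 1 < 0 := by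
    -- If `f 1 = 0`, positivity of `‖b‖ • 1 + b` gives `f b ≤ 0` for all `b`, contradicting `f 1 < u
    -- ≤ f (a + δ • 1)`.
    refine lt_of_le_of_ne (hneg 1 hone) fun h0 => ?_
    have hz : ∀ b, f b ≤ 0 := fun b => by
      have := hneg' (‖b‖ • (1 : selfAdjoint A) + b) (by
        have := isPos_norm_add b.2
        simpa [P] using this)
      simpa [h0] using this
    have h3 := h1 1 hone
    have := hz (a + δ • (1 : selfAdjoint A))
    linarith
  have hfa : 0 < f a := by
    rw [map_add, map_smul, smul_eq_mul] at h2
    nlinarith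
  refine ⟨ofReal ((f 1)⁻¹ • f.toLinearMap) (fun b hb => ?_) ?_, ?_⟩
  · exact mul_nonneg_of_nonpos_of_nonpos (inv_nonpos.2 hf1.le) (hneg' b hb)
  · exact inv_mul_cancel₀ hf1.ne
  · rw [ofReal_apply, Complex.ofReal_re]
    exact mul_neg_of_neg_of_pos (inv_neg''.2 hf1) hfa

theorem isPos_of_forall_re_apply_nonneg {a : A} (ha : IsSelfAdjoint a)
    (h : ∀ s : Stat A, 0 ≤ (s a).re) : IsPos a := by
  by_contra hn
  obtain ⟨s, hs⟩ := exists_re_apply_neg ⟨a, ha⟩ hn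
  exact absurd (h s) (not_le.2 hs)

theorem norm_le_of_forall_abs_re_apply_le {a : A} (ha : IsSelfAdjoint a) {r : ℝ} (hr : 0 ≤ r)
    (h : ∀ s : Stat A, |(s a).re| ≤ r) : ‖a‖ ≤ r := by
  have hone : IsSelfAdjoint ((r : ℂ) • (1 : A)) := (isPos_smul_one hr).isSelfAdjoint
  refine norm_le_of_isPos ha hr
    (isPos_of_forall_re_apply_nonneg (hone.sub ha) fun s => ?_)
    (isPos_of_forall_re_apply_nonneg (hone.add ha) fun s => ?_)
  · have := (abs_le.1 (h s)).2
    rw [map_sub, map_smul, PUMap.apply_one]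
    simpa using this
  · have := (abs_le.1 (h s)).1
    rw [map_add, map_smul, PUMap.apply_one]
    simpa [neg_le_iff_add_nonneg'] using this

end Stat


/-- Real and imaginary parts are bounded separately. The constant `2` is not sharp; any constant
gives norm continuity of states. -/
theorem Stat.norm_apply_le {A : Type u} [CStarAlgebra A] (s : Stat A) (a : A) :
    ‖s a‖ ≤ 2 * ‖a‖ := by
  have key : ∀ b : selfAdjoint A, ‖s (b : A)‖ ≤ ‖b‖ := fun b => by
    rw [← s.coe_re_apply b.2, Complex.norm_real]
    exact s.abs_re_apply_le b.2
  calc ‖s a‖ = ‖s (realPart a : A) + Complex.I * s (imaginaryPart a : A)‖ := by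
        conv_lhs => rw [← realPart_add_I_smul_imaginaryPart a, map_add, map_smul, smul_eq_mul]
    _ ≤ ‖s (realPart a : A)‖ + ‖s (imaginaryPart a : A)‖ := by
        refine (norm_add_le _ _).trans ?_
        simp
    _ ≤ ‖realPart a‖ + ‖imaginaryPart a‖ := add_le_add (key _) (key _)
    _ ≤ _ := by linarith [realPart.norm_le a, imaginaryPart.norm_le a]

/-! ### Weak-⋆ density of finite convex combinations of points -/

section Dense

variable {X : Type u} [TopologicalSpace X]

/-- A real continuous function regarded as a complex one. -/
def ofRealMap (f : C(X, ℝ)) : C(X, ℂ) := ⟨fun x => (f x : ℂ), by fun_prop⟩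

@[simp] theorem ofRealMap_apply (f : C(X, ℝ)) (x : X) : ofRealMap f x = (f x : ℂ) := rfl

variable [CompactSpace X]

theorem isPos_ofRealMap {f : C(X, ℝ)} (h : ∀ x, 0 ≤ f x) : IsPos (ofRealMap f) :=
  isPos_continuousMap fun x => isPos_complex.2 (by simpa using h x)

variable [T2Space X]

/-- With a partition of unity `ρ j` subordinate to small neighbourhoods of points `x j`, each `v` in
`I` is uniformly close to `∑ j, v (x j) • ρ j`, and `ν` sends this sum to the convex combination of
the `v (x j)` with weights `ν (ρ j)`. -/
theorem exists_convexState_near (ν : Stat C(X, ℂ)) (I : Finset C(X, ℂ)) {ε : ℝ} (hε : 0 < ε) :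
    ∃ (n : ℕ) (w : stdSimplex ℝ (Fin n)) (x : Fin n → X),
      ∀ v ∈ I, ‖convexState w x v - ν v‖ ≤ ε := by
  -- The half compensates for the constant `2` in `Stat.norm_apply_le`.
  let U : X → Set X := fun x => {y | ∀ v ∈ I, ‖v x - v y‖ < ε / 2}
  have hUo : ∀ x, IsOpen (U x) := fun x => by
    simp only [U, Set.ofPred_forall]
    exact isOpen_biInter_finset fun v _ => isOpen_lt (by fun_prop) continuous_const
  obtain ⟨t, ht⟩ := isCompact_univ.elim_finite_subcover U hUo fun x _ =>
    Set.mem_iUnion.2 ⟨x, fun v _ => by simpa using half_pos hε⟩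
  let x : Fin t.card → X := fun j => t.equivFin.symm j
  obtain ⟨ρ, hρ⟩ := PartitionOfUnity.exists_isSubordinate isClosed_univ (fun j => U (x j))
    (fun j => hUo _) (fun y hy => by
      obtain ⟨z, hz⟩ := Set.mem_iUnion.1 (ht hy)
      obtain ⟨hzt, hz⟩ := Set.mem_iUnion.1 hz
      exact Set.mem_iUnion.2 ⟨t.equivFin ⟨z, hzt⟩, by simpa [x] using hz⟩)
  have hsum : ∀ y, ∑ j, ρ j y = 1 := fun y => by
    rw [← finsum_eq_sum_of_fintype]
    exact ρ.sum_eq_one (Set.mem_univ y)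
  have hpos : ∀ j, IsPos (ofRealMap (ρ j)) := fun j => isPos_ofRealMap fun y => ρ.nonneg j y
  have hone : ∑ j, ofRealMap (ρ j) = 1 := by
    ext y
    rw [ContinuousMap.sum_apply]
    simp only [ofRealMap_apply, ContinuousMap.one_apply]
    rw [← Complex.ofReal_sum, hsum, Complex.ofReal_one]
  let w : stdSimplex ℝ (Fin t.card) := ⟨fun j => (ν (ofRealMap (ρ j))).re,
    fun j => (isPos_complex.1 (ν.isPos (hpos j))).1, by
      rw [← Complex.re_sum, ← map_sum, hone, PUMap.apply_one, Complex.one_re]⟩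
  refine ⟨t.card, w, x, fun v hv => ?_⟩
  have e : convexState w x v - ν v = ν (∑ j, v (x j) • ofRealMap (ρ j) - v) := by
    rw [map_sub ν, map_sum ν, convexState_apply]
    congr 1
    refine Finset.sum_congr rfl fun j _ => ?_
    rw [map_smul, smul_eq_mul, mul_comm]
    congr 1
    exact ν.coe_re_apply (hpos j).isSelfAdjoint
  rw [e]
  refine (ν.norm_apply_le _).trans ?_
  have : ‖∑ j, v (x j) • ofRealMap (ρ j) - v‖ ≤ ε / 2 := by
    refine (ContinuousMap.norm_le _ (half_pos hε).le).2 fun y => ?_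
    have e2 : (∑ j, v (x j) • ofRealMap (ρ j) - v) y =
        ∑ j, ((ρ j y : ℝ) : ℂ) * (v (x j) - v y) := by
      rw [ContinuousMap.sub_apply, ContinuousMap.sum_apply]
      simp only [mul_sub, Finset.sum_sub_distrib, ContinuousMap.smul_apply, smul_eq_mul,
        ofRealMap_apply]
      rw [← Finset.sum_mul, ← Complex.ofReal_sum, hsum, Complex.ofReal_one, one_mul]
      simp only [mul_comm]
    rw [e2]
    calc _ ≤ ∑ j, ‖((ρ j y : ℝ) : ℂ) * (v (x j) - v y)‖ := norm_sum_le _ _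
      _ ≤ ∑ j, ρ j y * (ε / 2) := by
        refine Finset.sum_le_sum fun j _ => ?_
        rw [norm_mul, Complex.norm_real, Real.norm_of_nonneg (ρ.nonneg j y)]
        -- Only the indices with `ρ j y ≠ 0` contribute, and for these subordination puts `y` in `U
        -- (x j)`.
        rcases eq_or_ne (ρ j y) 0 with h0 | h0
        · simp [h0]
        · exact mul_le_mul_of_nonneg_left (hρ j (subset_tsupport _ h0) v hv).le (ρ.nonneg j y)
      _ = ε / 2 := by rw [← Finset.sum_mul, hsum, one_mul]
  linarith

end Dense

theorem continuous_str (X : radon.{u}.Algebra) : Continuous (str X) := X.a.hom.hom.continuous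

/-- Continuous affine functions on an algebra of the Radon monad are integrated by the structure
map: a state is a weak-⋆ limit of convex combinations of points. -/
theorem AffMap.apply_str {X : radon.{u}.Algebra} (f : AffMap X) (ν : Stat C(X.A, ℂ)) :
    f (str X ν) = mean ν ⟨f, f.continuous_toFun⟩ := by
  classical
  let p : C(X.A, unitInterval) := ⟨f, f.continuous_toFun⟩
  -- A net converging to `ν`: the index prescribes the finite set of test functions and the
  -- precision.
  choose n w x h using fun i : Finset C(X.A, ℂ) × ℕ =>
    exists_convexState_near ν i.1 (Nat.one_div_pos_of_nat (α := ℝ) (n := i.2))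
  have ht : Filter.Tendsto (fun i => convexState (w i) (x i)) Filter.atTop (nhds ν) := by
    rw [Stat.isInducing_coe.tendsto_nhds_iff, tendsto_pi_nhds]
    intro v
    rw [tendsto_iff_norm_sub_tendsto_zero, ← Filter.prod_atTop_atTop_eq]
    refine squeeze_zero' (Filter.Eventually.of_forall fun _ => norm_nonneg _) ?_
      (tendsto_one_div_add_atTop_nhds_zero_nat.comp Filter.tendsto_snd)
    rw [Filter.prod_atTop_atTop_eq]
    filter_upwards [Filter.eventually_ge_atTop ({v}, 0)] with i hi
    exact h i v (hi.1 (Finset.mem_singleton_self v))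
  have h1 : Filter.Tendsto (fun i => f (str X (convexState (w i) (x i)))) Filter.atTop
      (nhds (f (str X ν))) :=
    ((f.continuous_toFun.comp (continuous_str X)).tendsto ν).comp ht
  have h2 : Filter.Tendsto (fun i => mean (convexState (w i) (x i)) p) Filter.atTop
      (nhds (mean ν p)) := ((continuous_mean p).tendsto ν).comp ht
  refine tendsto_nhds_unique h1 (h2.congr fun i => Subtype.ext ?_)
  refine Eq.trans ?_ (f.affine (w i) (x i)).symm
  change (convexState (w i) (x i) (toEffect p).1).re = _
  rw [convexState_apply, Complex.re_sum]
  refine Finset.sum_congr rfl fun j _ => ?_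
  rw [Complex.re_ofReal_mul]
  rfl


/-! ### Extending maps on effects to states -/

section Extension

variable {A : Type u} [CStarAlgebra A]

theorem IsPos.exists_effect_smul {a : A} (ha : IsPos a) :
    ∃ (r : ℝ) (x : Effect A), 0 < r ∧ a = (r : ℂ) • x.1 := by
  have hr : (0 : ℝ) < ‖a‖ + 1 := by positivity
  have hr' : ((‖a‖ + 1 : ℝ) : ℂ) ≠ 0 := Complex.ofReal_ne_zero.2 hr.ne'
  refine ⟨‖a‖ + 1, ⟨(((‖a‖ + 1)⁻¹ : ℝ) : ℂ) • a, ha.smul (inv_nonneg.2 hr.le), ?_⟩, hr, ?_⟩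
  · have := ((isPos_norm_sub ha.isSelfAdjoint).add isPos_one).smul (inv_nonneg.2 hr.le)
    convert this using 1
    rw [show ((‖a‖ : ℝ) : ℂ) • (1 : A) - a + 1 = ((‖a‖ + 1 : ℝ) : ℂ) • (1 : A) - a by
      push_cast; rw [add_smul, one_smul]; abel, smul_sub, smul_smul, ← Complex.ofReal_mul,
      inv_mul_cancel₀ hr.ne', Complex.ofReal_one, one_smul]
  · rw [smul_smul, ← Complex.ofReal_mul, mul_inv_cancel₀ hr.ne', Complex.ofReal_one, one_smul]

/-- Take `x = (r + a) / (2r)` with `r = ‖a‖ + 1`; the summand `1` keeps `r` invertible when `a = 0`.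
-/
theorem exists_effect_eq (a : selfAdjoint A) :
    ∃ (r : ℝ) (x : Effect A), 0 ≤ r ∧ (a : A) = ((2 * r : ℝ) : ℂ) • x.1 - (r : ℂ) • 1 := by
  let r : ℝ := ‖(a : A)‖ + 1
  have hr : 0 < 2 * r := by positivity
  have h1 : IsPos ((r : ℂ) • (1 : A) + a) := by
    convert (isPos_norm_add a.2).add isPos_one using 1
    simp only [r, Complex.ofReal_add, Complex.ofReal_one, add_smul, one_smul]
    abel
  have h2 : IsPos ((r : ℂ) • (1 : A) - a) := by
    convert (isPos_norm_sub a.2).add isPos_one using 1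
    simp only [r, Complex.ofReal_add, Complex.ofReal_one, add_smul, one_smul]
    abel
  have hc : ((2 * r : ℝ) : ℂ) * (((2 * r)⁻¹ : ℝ) : ℂ) = 1 := by
    rw [← Complex.ofReal_mul, mul_inv_cancel₀ hr.ne', Complex.ofReal_one]
  refine ⟨r, ⟨(((2 * r)⁻¹ : ℝ) : ℂ) • ((r : ℂ) • (1 : A) + a), h1.smul (inv_nonneg.2 hr.le), ?_⟩,
    by positivity, ?_⟩
  · convert h2.smul (inv_nonneg.2 hr.le) using 1
    rw [sub_eq_iff_eq_add, ← smul_add,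
      show (r : ℂ) • (1 : A) - a + ((r : ℂ) • (1 : A) + a) = ((2 * r : ℝ) : ℂ) • (1 : A) by
        push_cast; module, smul_smul, mul_comm, hc, one_smul]
  · rw [smul_smul, hc, one_smul]
    abel

namespace EModDual

variable (φ : EModDual (Effect A))

/-- Division by `N` brings the scalars into `[0,1]` and makes the partial sum defined, so the axioms
for `φ` apply to the quotient `e`. -/
theorem exists_effect_combination {p q N : ℝ} (hp : 0 ≤ p) (hq : 0 ≤ q) (hN : 0 < N)
    (h : p + q ≤ N) (x y : Effect A) :
    ∃ e : Effect A, (N : ℂ) • e.1 = (p : ℂ) • x.1 + (q : ℂ) • y.1 ∧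
      N * (φ e : ℝ) = p * φ x + q * φ y := by
  let r : unitInterval := ⟨p / N, by positivity, (div_le_one hN).2 (by linarith)⟩
  let t : unitInterval := ⟨q / N, by positivity, (div_le_one hN).2 (by linarith)⟩
  have hN' : (N : ℂ) ≠ 0 := Complex.ofReal_ne_zero.2 hN.ne'
  let e : Effect A := ⟨((p / N : ℝ) : ℂ) • x.1 + ((q / N : ℝ) : ℂ) • y.1,
    (x.2.1.smul r.2.1).add (y.2.1.smul t.2.1), by
      have h1 := (x.2.2.smul r.2.1).add (y.2.2.smul t.2.1)
      have h2 : IsPos (((1 - p / N - q / N : ℝ) : ℂ) • (1 : A)) := isPos_smul_one (by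
        have : p / N + q / N ≤ 1 := by rw [← add_div]; exact (div_le_one hN).2 h
        linarith)
      have := h1.add h2
      convert this using 1
      simp only [r, t, smul_sub, sub_smul, Complex.ofReal_sub, Complex.ofReal_one, one_smul]
      abel⟩
  refine ⟨e, ?_, ?_⟩
  · change (N : ℂ) • (((p / N : ℝ) : ℂ) • x.1 + ((q / N : ℝ) : ℂ) • y.1) = _
    rw [smul_add, smul_smul, smul_smul, ← Complex.ofReal_mul, ← Complex.ofReal_mul,
      mul_div_cancel₀ _ hN.ne', mul_div_cancel₀ _ hN.ne']
  · have h1 : (φ (EffectModule.smul r x) : ℝ) + φ (EffectModule.smul t y) = φ e :=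
      φ.map_osum rfl
    have h2 : (φ (EffectModule.smul r x) : ℝ) = p / N * φ x :=
      congrArg Subtype.val (φ.map_smul r x)
    have h3 : (φ (EffectModule.smul t y) : ℝ) = q / N * φ y :=
      congrArg Subtype.val (φ.map_smul t y)
    rw [← h1, h2, h3]
    field_simp

/-- Well-definedness of the linear extension: for a common `N`, both sides are `N` times the same
effect. The final `1` in `N` keeps it positive when all coefficients vanish. -/
theorem combination_congr {p q t u : ℝ} (hp : 0 ≤ p) (hq : 0 ≤ q) (ht : 0 ≤ t) (hu : 0 ≤ u)
    {x y z w : Effect A}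
    (h : (p : ℂ) • x.1 + (q : ℂ) • y.1 = (t : ℂ) • z.1 + (u : ℂ) • w.1) :
    p * (φ x : ℝ) + q * φ y = t * φ z + u * φ w := by
  have hN : 0 < p + q + t + u + 1 := by positivity
  obtain ⟨e, he, he'⟩ := exists_effect_combination φ hp hq hN (by linarith) x y
  obtain ⟨f, hf, hf'⟩ := exists_effect_combination φ ht hu hN (by linarith) z w
  rw [← he, ← hf] at h
  have : e = f := Subtype.ext
    (smul_right_injective A (Complex.ofReal_ne_zero.2 hN.ne') h)
  rw [← he', ← hf', this]

theorem apply_effect_one : (φ (EffectAlgebra.one : Effect A) : ℝ) = 1 :=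
  congrArg Subtype.val φ.map_one

theorem effect_one_val : (EffectAlgebra.one : Effect A).1 = 1 := rfl

/-- The value at a self-adjoint element of the linear extension of a map on effects. -/
def extendFun (a : selfAdjoint A) : ℝ :=
  2 * (exists_effect_eq a).choose * φ (exists_effect_eq a).choose_spec.choose -
    (exists_effect_eq a).choose

variable {φ}

theorem extendFun_eq {a : selfAdjoint A} {r : ℝ} {x : Effect A} (hr : 0 ≤ r)
    (h : (a : A) = ((2 * r : ℝ) : ℂ) • x.1 - (r : ℂ) • 1) :
    extendFun φ a = 2 * r * φ x - r := by
  have h1 := (exists_effect_eq a).choose_spec.choose_spec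
  unfold extendFun
  set r' := (exists_effect_eq a).choose
  set x' := (exists_effect_eq a).choose_spec.choose
  -- The two representations of `a` are compared after moving the negative terms across, so that all
  -- coefficients are nonnegative.
  have := combination_congr φ (p := 2 * r') (q := r) (t := 2 * r) (u := r') (x := x')
    (y := EffectAlgebra.one) (z := x) (w := EffectAlgebra.one) (by linarith) hr (by linarith) h1.1
    (by
      rw [h1.2, sub_eq_sub_iff_add_eq_add] at h
      simpa only [effect_one_val] using h)
  rw [apply_effect_one] at this
  linarith

theorem extendFun_add (a b : selfAdjoint A) :
    extendFun φ (a + b) = extendFun φ a + extendFun φ b := by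
  obtain ⟨r, x, hr, hx⟩ := exists_effect_eq a
  obtain ⟨t, y, ht, hy⟩ := exists_effect_eq b
  obtain ⟨N, z, hN, hz⟩ := exists_effect_eq (a + b)
  rw [extendFun_eq hr hx, extendFun_eq ht hy, extendFun_eq hN hz]
  obtain ⟨e, he, he'⟩ := exists_effect_combination φ (p := 2 * r) (q := 2 * t)
    (N := 2 * r + 2 * t + 1) (by linarith) (by linarith) (by linarith) (by linarith) x y
  have := combination_congr φ (p := 2 * r + 2 * t + 1) (q := N) (t := 2 * N) (u := r + t) (x := e)
    (y := EffectAlgebra.one) (z := z) (w := EffectAlgebra.one) (by linarith) hN (by linarith)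
    (by linarith)
    (by
      rw [AddSubgroup.coe_add, hx, hy] at hz
      rw [he, effect_one_val, ← sub_eq_zero]
      rw [← sub_eq_zero] at hz
      rw [← hz]
      push_cast
      module)
  rw [apply_effect_one] at this
  linarith

theorem extendFun_smul (c : ℝ) (a : selfAdjoint A) :
    extendFun φ (c • a) = c * extendFun φ a := by
  obtain ⟨r, x, hr, hx⟩ := exists_effect_eq a
  rw [extendFun_eq hr hx]
  rcases le_total 0 c with hc | hc
  · rw [extendFun_eq (r := c * r) (x := x) (mul_nonneg hc hr)]
    · ring
    · rw [selfAdjoint.val_smul, hx, ← Complex.coe_smul]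
      simp only [smul_sub, smul_smul]
      push_cast
      congr 2; ring
  -- A negative scalar needs the complement: `c (2r x - r) = 2(-c r)(1 - x) - (-c r)`.
  · rw [extendFun_eq (r := -c * r) (x := EffectAlgebra.compl x) (mul_nonneg (neg_nonneg.2 hc) hr)]
    · have : (φ x : ℝ) + φ (EffectAlgebra.compl x) = 1 := by
        rw [← apply_effect_one φ]
        exact φ.map_osum (EffectAlgebra.osum_compl x)
      have e : (φ (EffectAlgebra.compl x) : ℝ) = 1 - φ x := by linarith
      rw [e]
      ring
    · rw [selfAdjoint.val_smul, hx, ← Complex.coe_smul,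
        show (EffectAlgebra.compl x).1 = 1 - x.1 from rfl]
      simp only [smul_sub, smul_smul]
      push_cast
      module

theorem extendFun_effect (x : Effect A) :
    extendFun φ ⟨x.1, x.2.1.isSelfAdjoint⟩ = φ x := by
  let a : selfAdjoint A := ⟨x.1, x.2.1.isSelfAdjoint⟩
  obtain ⟨r, y, hr, hy⟩ := exists_effect_eq a
  rw [extendFun_eq hr hy]
  have := combination_congr φ (p := 2 * r) (q := 0) (t := 1) (u := r) (x := y)
    (y := EffectAlgebra.one) (z := x) (w := EffectAlgebra.one) (by linarith) le_rfl zero_le_one hr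
    (by
      rw [show x.1 = _ from hy, effect_one_val]
      simp)
  rw [apply_effect_one] at this
  linarith

variable (φ)

/-- The state extending a map of effect modules `[0,1]_A → [0,1]`. -/
def toStat : Stat A :=
  Stat.ofReal
    { toFun := extendFun φ
      map_add' := extendFun_add
      map_smul' := extendFun_smul }
    (fun a ha => by
      obtain ⟨r, x, hr, hx⟩ := ha.exists_effect_smul
      have e : a = r • ⟨x.1, x.2.1.isSelfAdjoint⟩ := Subtype.ext (by simpa using hx)
      change 0 ≤ extendFun φ a
      rw [e, extendFun_smul, extendFun_effect]
      exact mul_nonneg hr.le (φ x).2.1)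
    ((extendFun_effect EffectAlgebra.one).trans (apply_effect_one φ))

theorem prob_toStat (x : Effect A) : (toStat φ).prob x = φ x := by
  refine Subtype.ext ?_
  refine Eq.trans (congrArg Complex.re
    (Stat.ofReal_apply _ _ _ ⟨x.1, x.2.1.isSelfAdjoint⟩)) ?_
  exact extendFun_effect x

end EModDual

theorem Stat.ext_prob {s t : Stat A} (h : ∀ x : Effect A, s.prob x = t.prob x) : s = t := by
  refine Stat.ext_selfAdjoint fun a ha => ?_
  obtain ⟨r, x, -, e⟩ := exists_effect_eq ⟨a, ha⟩
  change a = _ at e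
  subst e
  have hx : s x.1 = t x.1 := by rw [← prob_coe, ← prob_coe, h]
  rw [map_sub, map_sub, map_smul, map_smul, map_smul, map_smul, hx, PUMap.apply_one,
    PUMap.apply_one]

end Extension


/-! ### Uniform approximation from states, by separation -/

section RealFunctional

variable {X : Type u} [TopologicalSpace X]

/-- The real part of a complex continuous function, as a real linear map. -/
def reMap (X : Type u) [TopologicalSpace X] : C(X, ℂ) →ₗ[ℝ] C(X, ℝ) where
  toFun v := ⟨fun x => (v x).re, by fun_prop⟩
  map_add' _ _ := rfl
  map_smul' r v := ContinuousMap.ext fun x => by simp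

theorem isSelfAdjoint_ofRealMap (g : C(X, ℝ)) : IsSelfAdjoint (ofRealMap g) :=
  ContinuousMap.ext fun x => Complex.conj_ofReal (g x)

variable [CompactSpace X]

/-- A positive unital functional on real continuous functions, as a state. -/
def stateOfReal (μ : C(X, ℝ) →ₗ[ℝ] ℝ) (hpos : ∀ g : C(X, ℝ), 0 ≤ g → 0 ≤ μ g)
    (hone : μ 1 = 1) : Stat C(X, ℂ) :=
  Stat.ofReal (μ ∘ₗ reMap X ∘ₗ (selfAdjoint.submodule ℝ C(X, ℂ)).subtype)
    (fun _ ha => hpos _ fun x => (isPos_complex.1 (ha.apply x)).1)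
    (by
      refine Eq.trans (congrArg μ (ContinuousMap.ext fun x => ?_)) hone
      exact Complex.one_re)

theorem stateOfReal_ofRealMap (μ : C(X, ℝ) →ₗ[ℝ] ℝ) (hpos : ∀ g : C(X, ℝ), 0 ≤ g → 0 ≤ μ g)
    (hone : μ 1 = 1) (g : C(X, ℝ)) :
    stateOfReal μ hpos hone (ofRealMap g) = ((μ g : ℝ) : ℂ) :=
  Stat.ofReal_apply _ _ _ ⟨ofRealMap g, isSelfAdjoint_ofRealMap g⟩

end RealFunctional

theorem nonpos_of_forall_pos_mul_lt {x u : ℝ} (h : ∀ t : ℝ, 0 < t → t * x < u) :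
    x ≤ 0 ∧ 0 ≤ u := by
  have hx : x ≤ 0 := by
    by_contra! hx
    have h1 := h 1 one_pos
    have := h (u / x) (div_pos (by linarith) hx)
    rw [div_mul_cancel₀ _ hx.ne'] at this
    exact lt_irrefl _ this
  refine ⟨hx, ?_⟩
  by_contra! hu
  have h1 := h 1 one_pos
  have hx' : x < 0 := by linarith
  have := h (u / x) (div_pos_of_neg_of_neg hu hx')
  rw [div_mul_cancel₀ _ hx'.ne] at this
  exact lt_irrefl _ this

theorem eq_zero_of_forall_le_mul {x c : ℝ} (h : ∀ t : ℝ, c ≤ t * x) : x = 0 := by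
  by_contra hx
  have := h ((c - 1) / x)
  rw [div_mul_cancel₀ _ hx] at this
  linarith

/-- A subspace `V` of continuous functions that contains the constants, and a continuous function
`f` such that any two states that agree on `V` agree at `f`: then `f` is a uniform limit of
elements of `V`. -/
theorem exists_mem_near_of_states {X : Type u} [TopologicalSpace X] [CompactSpace X]
    (V : Submodule ℝ C(X, ℝ)) (hV : 1 ∈ V) (f : C(X, ℝ))
    (hf : ∀ ν₁ ν₂ : Stat C(X, ℂ), (∀ v ∈ V, ν₁ (ofRealMap v) = ν₂ (ofRealMap v)) →
      ν₁ (ofRealMap f) = ν₂ (ofRealMap f)) {ε : ℝ} (hε : 0 < ε) :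
    ∃ v ∈ V, ∀ x, |f x - v x| < ε := by
  by_contra! hno
  let N : Set C(X, ℝ) := {g | ∀ x, g x < 0}
  have hN : IsOpen N := by
    have := ContinuousMap.isOpen_setOfPred_mapsTo (X := X) (Y := ℝ) isCompact_univ
      (isOpen_Iio (a := (0 : ℝ)))
    convert this using 1
    ext g
    simp [N, Set.MapsTo]
  have hNc : Convex ℝ N := fun g hg h hh a b ha hb hab x => by
    have h1 := hg x
    have h2 := hh x
    simp only [ContinuousMap.add_apply, ContinuousMap.smul_apply, smul_eq_mul]
    rcases ha.eq_or_lt with rfl | ha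
    · rw [zero_add] at hab
      subst hab
      linarith
    · nlinarith
  have hNs : ∀ t : ℝ, 0 < t → ∀ g ∈ N, t • g ∈ N := fun t ht g hg x =>
    mul_neg_of_pos_of_neg ht (hg x)
  -- A pair in `W` has both entries negative everywhere exactly when `|f - v| < ε` everywhere. So
  -- the failure of approximation means that `W` misses the open convex cone `N × N`.
  let W : Set (C(X, ℝ) × C(X, ℝ)) :=
    (fun v : C(X, ℝ) => (v - f - ε • 1, f - v - ε • 1)) '' V
  have hW : Convex ℝ W := by
    rintro _ ⟨v, hv, rfl⟩ _ ⟨v', hv', rfl⟩ a b ha hb hab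
    refine ⟨a • v + b • v', V.add_mem (V.smul_mem _ hv) (V.smul_mem _ hv'), ?_⟩
    obtain rfl : b = 1 - a := by linarith
    refine Prod.ext ?_ ?_
    · simp only [Prod.fst_add, Prod.smul_fst]
      module
    · simp only [Prod.snd_add, Prod.smul_snd]
      module
  obtain ⟨F, u, hF, hFW⟩ := geometric_hahn_banach_open (hNc.prod hNc) (hN.prod hN) hW (by
    rw [Set.disjoint_left]
    rintro _ h ⟨v, hv, rfl⟩
    obtain ⟨x, hx⟩ := hno v hv
    have h1 := h.1 x
    have h2 := h.2 x
    simp at h1 h2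
    exact absurd (abs_lt.2 ⟨by linarith, by linarith⟩) (not_lt.2 hx))
  let μ : C(X, ℝ) →ₗ[ℝ] ℝ := F.toLinearMap ∘ₗ LinearMap.inl ℝ _ _
  let ν : C(X, ℝ) →ₗ[ℝ] ℝ := F.toLinearMap ∘ₗ LinearMap.inr ℝ _ _
  have hFμν : ∀ g h, F (g, h) = μ g + ν h := fun g h => by
    change _ = F (g, 0) + F (0, h)
    rw [← map_add]
    simp
  have hcone : ∀ g ∈ N, ∀ h ∈ N, μ g + ν h ≤ 0 ∧ 0 ≤ u := fun g hg h hh => by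
    refine nonpos_of_forall_pos_mul_lt fun t ht => ?_
    have := hF (t • g, t • h) ⟨hNs t ht g hg, hNs t ht h hh⟩
    rwa [hFμν, map_smul, map_smul, smul_eq_mul, smul_eq_mul, ← mul_add] at this
  have hneg : (-1 : C(X, ℝ)) ∈ N := fun x => by simp
  have hu : 0 ≤ u := (hcone _ hneg _ hneg).2
  -- The cone `N × N` contains only strictly negative pairs. Nonnegative functions are reached by
  -- subtracting `δ` in both coordinates and letting `δ` tend to `0`, which shows that `μ` and `ν`
  -- are positive.
  have hpert : ∀ g : C(X, ℝ), 0 ≤ g → ∀ δ : ℝ, 0 < δ → -g - δ • 1 ∈ N := fun g hg δ hδ x => by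
    have := hg x
    simp at this ⊢
    linarith
  have hlim : ∀ x c : ℝ, (∀ δ : ℝ, 0 < δ → -x - δ * c ≤ 0) → 0 ≤ x := fun x c h => by
    by_contra! hx
    have h1 := h 1 one_pos
    have hc : 0 < c := by linarith
    have h2 := h (-x / (2 * c)) (div_pos (by linarith) (by linarith))
    rw [show -x / (2 * c) * c = -x / 2 by field_simp] at h2
    linarith
  have hμ : ∀ g : C(X, ℝ), 0 ≤ g → 0 ≤ μ g := fun g hg => by
    refine hlim _ (μ 1 + ν 1) fun δ hδ => ?_
    have := (hcone _ (hpert g hg δ hδ) _ (hpert 0 le_rfl δ hδ)).1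
    simp only [map_sub, map_neg, map_smul, smul_eq_mul, map_zero] at this
    linarith
  have hν : ∀ g : C(X, ℝ), 0 ≤ g → 0 ≤ ν g := fun g hg => by
    refine hlim _ (μ 1 + ν 1) fun δ hδ => ?_
    have := (hcone _ (hpert 0 le_rfl δ hδ) _ (hpert g hg δ hδ)).1
    simp only [map_sub, map_neg, map_smul, smul_eq_mul, map_zero] at this
    linarith
  have hle : ∀ v ∈ V, u ≤ (μ v - ν v) - (μ f - ν f) - ε * (μ 1 + ν 1) := fun v hv => by
    have := hFW _ ⟨v, hv, rfl⟩
    rw [hFμν] at this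
    simp only [map_sub, map_smul, smul_eq_mul] at this
    linarith
  -- A linear functional that is bounded below on a subspace vanishes there; here it is `μ - ν` on
  -- `V`.
  have heq : ∀ v ∈ V, μ v = ν v := fun v hv => by
    refine sub_eq_zero.1 (eq_zero_of_forall_le_mul
      (c := u + (μ f - ν f) + ε * (μ 1 + ν 1)) fun t => ?_)
    have := hle (t • v) (V.smul_mem t hv)
    simp only [map_smul, smul_eq_mul] at this
    linarith
  have h1 : μ 1 = ν 1 := heq 1 hV
  have h0 := hle 0 V.zero_mem
  rw [map_zero, map_zero] at h0
  -- If `μ 1 = ν 1 = 0`, positivity kills both functionals at `f`, giving `0 < u` from `(-1, -1)`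
  -- and `u ≤ 0` from `v = 0`. Otherwise both normalise to states that agree on `V`, hence at `f`,
  -- and `u ≤ -2 * ε * μ 1 < 0` contradicts `0 ≤ u`.
  rcases (hμ 1 zero_le_one).eq_or_lt with hk | hk
  · have hz : ∀ κ : C(X, ℝ) →ₗ[ℝ] ℝ, (∀ g : C(X, ℝ), 0 ≤ g → 0 ≤ κ g) → κ 1 = 0 → κ f = 0 := by
      intro κ hκ hκ1
      have e1 := hκ (‖f‖ • 1 - f) fun x => by
        simpa using (le_abs_self _).trans (f.norm_coe_le_norm x)
      have e2 := hκ (‖f‖ • 1 + f) fun x => by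
        have := (neg_le_abs _).trans (f.norm_coe_le_norm x)
        simp
        linarith
      simp only [map_sub, map_add, map_smul, smul_eq_mul, hκ1] at e1 e2
      linarith
    have hFu := hF (-1, -1) ⟨hneg, hneg⟩
    rw [hFμν, map_neg, map_neg, ← h1, ← hk] at hFu
    rw [hz μ hμ hk.symm, hz ν hν (h1.symm.trans hk.symm), ← h1, ← hk] at h0
    linarith
  · let k := μ 1
    have hkν : (k⁻¹ • ν) 1 = 1 := by
      change k⁻¹ * ν 1 = 1
      rw [← h1]
      exact inv_mul_cancel₀ hk.ne'
    have key := hf (stateOfReal (k⁻¹ • μ) (fun g hg => mul_nonneg (inv_nonneg.2 hk.le) (hμ g hg))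
      (inv_mul_cancel₀ hk.ne'))
      (stateOfReal (k⁻¹ • ν) (fun g hg => mul_nonneg (inv_nonneg.2 hk.le) (hν g hg)) hkν)
      (fun v hv => by
        rw [stateOfReal_ofRealMap, stateOfReal_ofRealMap, LinearMap.smul_apply,
          LinearMap.smul_apply, heq v hv])
    rw [stateOfReal_ofRealMap, stateOfReal_ofRealMap, LinearMap.smul_apply,
      LinearMap.smul_apply, Complex.ofReal_inj, smul_eq_mul, smul_eq_mul,
      mul_right_inj' (inv_ne_zero hk.ne')] at key
    rw [key, ← h1] at h0
    nlinarith [mul_pos hε hk]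

/-! ### Kadison's representation theorem -/

section Kadison

variable {A : Type u} [CStarAlgebra A]

/-- The real function on the state space given by a self-adjoint element. -/
def evReal (A : Type u) [CStarAlgebra A] : selfAdjoint A →ₗ[ℝ] C(Stat A, ℝ) where
  toFun a := ⟨fun s => (s (a : A)).re, Complex.continuous_re.comp (Stat.continuous_eval _)⟩
  map_add' a b := ContinuousMap.ext fun s => by simp
  map_smul' r a := ContinuousMap.ext fun s => by
    simp only [selfAdjoint.val_smul, ContinuousMap.coe_mk]
    rw [← Complex.coe_smul, map_smul]
    simp

@[simp] theorem evReal_apply (a : selfAdjoint A) (s : Stat A) :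
    evReal A a s = (s (a : A)).re := rfl

theorem ofRealMap_evReal (a : selfAdjoint A) : ofRealMap (evReal A a) = evStat A (a : A) :=
  ContinuousMap.ext fun s => s.coe_re_apply a.2

/-- States on `C(Stat A, ℂ)` that agree on all evaluations have the same barycentre, and the
integral of an affine `f` is its value at the barycentre. The approximation theorem therefore
applies to the range of `evReal A`. -/
theorem exists_evReal_near (f : AffMap (statAlgebra A)) {ε : ℝ} (hε : 0 < ε) :
    ∃ a : selfAdjoint A, ∀ s : Stat A, |(f s : ℝ) - (s (a : A)).re| < ε := by
  let p : C(Stat A, unitInterval) := ⟨f, f.continuous_toFun⟩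
  obtain ⟨_, ⟨a, rfl⟩, ha⟩ := exists_mem_near_of_states (LinearMap.range (evReal A))
    ⟨1, ContinuousMap.ext fun s => by simp⟩
    ⟨fun s => (p s : ℝ), by fun_prop⟩ (fun ν₁ ν₂ h => by
      have hb : barycentre A ν₁ = barycentre A ν₂ := Stat.ext_selfAdjoint fun a ha => by
        have := h _ ⟨⟨a, ha⟩, rfl⟩
        rw [ofRealMap_evReal] at this
        exact congrArg Complex.re this
      have e : mean ν₁ p = mean ν₂ p :=
        (f.apply_str ν₁).symm.trans ((congrArg f hb).trans (f.apply_str ν₂))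
      exact (mean_coe ν₁ p).symm.trans ((congrArg (fun t : unitInterval => ((t : ℝ) : ℂ)) e).trans
        (mean_coe ν₂ p))) hε
  exact ⟨a, ha⟩

/-- Kadison's representation theorem for `[0,1]`-valued functions: a continuous affine function on
the state space is given by an effect. -/
theorem exists_effect_prob_eq (f : AffMap (statAlgebra A)) :
    ∃ a : Effect A, ∀ s : Stat A, s.prob a = f s := by
  choose a ha using fun n : ℕ => exists_evReal_near f (Nat.one_div_pos_of_nat (α := ℝ) (n := n))
  have hlim := tendsto_one_div_add_atTop_nhds_zero_nat (𝕜 := ℝ)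
  -- Uniform closeness on states is norm closeness, since states determine the norm of self-adjoint
  -- elements.
  have hdist : ∀ n m, dist (a n : A) (a m) ≤ 1 / ((n : ℝ) + 1) + 1 / ((m : ℝ) + 1) := by
    intro n m
    rw [dist_eq_norm]
    refine Stat.norm_le_of_forall_abs_re_apply_le ((a n).2.sub (a m).2) (by positivity) fun s => ?_
    rw [map_sub, Complex.sub_re]
    have h1 := abs_lt.1 (ha n s)
    have h2 := abs_lt.1 (ha m s)
    exact abs_le.2 ⟨by linarith, by linarith⟩
  have hc : CauchySeq fun n => (a n : A) := by
    refine cauchySeq_of_le_tendsto_0 (fun N : ℕ => 1 / ((N : ℝ) + 1) + 1 / ((N : ℝ) + 1))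
      (fun n m N hn hm => (hdist n m).trans ?_) (by simpa using hlim.add hlim)
    gcongr
  obtain ⟨b, hb⟩ := cauchySeq_tendsto_of_complete hc
  have hbs : IsSelfAdjoint b := by
    have : IsClosed {x : A | IsSelfAdjoint x} := isClosed_eq continuous_star continuous_id
    exact this.mem_of_tendsto hb (Filter.Eventually.of_forall fun n => (a n).2)
  have hval : ∀ s : Stat A, (s b).re = f s := fun s => by
    have hs : Continuous s :=
      (s.toLinearMap.mkContinuous 2 s.norm_apply_le).continuous
    refine tendsto_nhds_unique (((Complex.continuous_re.comp hs).tendsto b).comp hb) ?_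
    rw [tendsto_iff_dist_tendsto_zero]
    refine squeeze_zero (fun _ => dist_nonneg) (fun n => ?_) hlim
    rw [dist_comm, Real.dist_eq]
    exact (ha n s).le
  refine ⟨⟨b, Stat.isPos_of_forall_re_apply_nonneg hbs fun s => ?_,
    Stat.isPos_of_forall_re_apply_nonneg ((IsSelfAdjoint.one A).sub hbs) fun s => ?_⟩,
    fun s => Subtype.ext (hval s)⟩
  · rw [hval]
    exact (f s).2.1
  · rw [map_sub, PUMap.apply_one, Complex.sub_re, hval, Complex.one_re, sub_nonneg]
    exact (f s).2.2

end Kadison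


/-! ### The adjunction by exchange of arguments -/

theorem mean_convexState {X : Type u} [TopologicalSpace X] [CompactSpace X] {n : ℕ}
    (w : stdSimplex ℝ (Fin n)) (x : Fin n → X) (p : C(X, unitInterval)) :
    (mean (convexState w x) p : ℝ) = ∑ i, w.1 i * p (x i) := by
  change (convexState w x (toEffect p).1).re = _
  rw [convexState_apply, Complex.re_sum]
  refine Finset.sum_congr rfl fun j _ => ?_
  rw [Complex.re_ofReal_mul]
  rfl

section Adjunction

variable {X : radon.{u}.Algebra} {M : Type u} [EffectModule M]

/-- Exchanging the arguments of a map of effect modules `M → 𝒜(X,[0,1])`. -/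
def algebraHomOfEModHom (f : EModHom M (AffMap X)) : X ⟶ dualAlgebra M where
  f := CompHausLike.ofHom _
    ⟨fun x => ({ toFun := fun m => f m x
                 map_osum := fun h => f.map_osum h x
                 map_one := congrArg (fun p : AffMap X => p x) f.map_one
                 map_smul := fun r m => congrArg (fun p : AffMap X => p x) (f.map_smul r m) } :
        EModDual M),
      EModDual.continuous_iff.2 fun m => (f m).continuous_toFun⟩
  h := by
    ext ν
    -- Compatibility with the structure maps is, for each `m`, the integral formula for the affine
    -- function `f m`.
    exact EModHom.ext (funext fun m => ((f m).apply_str ν).symm)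

/-- Exchanging the arguments of a map of algebras `X → EMod(M,[0,1])`. -/
def eModHomOfAlgebraHom (g : X ⟶ dualAlgebra M) : EModHom M (AffMap X) where
  toFun m :=
    { toFun := fun x => EModHom.toFun (g.f x : EModDual M) m
      continuous_toFun := (EModDual.continuous_eval m).comp g.f.hom.hom.continuous
      affine := fun w x => by
        rw [map_convexSum]
        exact mean_convexState w _ (evDual m) }
  map_osum h x := (g.f x : EModDual M).map_osum h
  map_one := AffMap.ext (funext fun x => (g.f x : EModDual M).map_one)
  map_smul r m := AffMap.ext (funext fun x => (g.f x : EModDual M).map_smul r m)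

end Adjunction

/-- `𝒜(-,[0,1])` is left adjoint to `EMod(-,[0,1])`. -/
def affHomAdjunction : affHom.{u} ⊣ emodHom.{u} :=
  Adjunction.mkOfHomEquiv
    { homEquiv := fun _ M =>
        { toFun := fun f => algebraHomOfEModHom (M := M.unop.carrier) f.unop
          invFun := fun g => Quiver.Hom.op (eModHomOfAlgebraHom g : EModHom _ _)
          left_inv := fun _ => rfl
          right_inv := fun _ => rfl }
      homEquiv_naturality_left_symm := fun _ _ => rfl
      homEquiv_naturality_right := fun _ _ => rfl }

/-- A bijective map of algebras of the Radon monad is an isomorphism. -/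
def algebraIsoOfBijective {X Y : radon.{u}.Algebra} (g : X ⟶ Y)
    (hg : Function.Bijective fun x : X.A => g.f x) : X ≅ Y :=
  haveI := CompHausLike.isIso_of_bijective g.f hg
  haveI := Monad.algebra_iso_of_iso _ g
  asIso g

/-- A bijective map of effect modules that reflects partial sums is an isomorphism. -/
def eModIsoOfBijective {M N : Type u} [EffectModule M] [EffectModule N] (f : EModHom M N)
    (hf : Function.Bijective f) (hosum : ∀ x y z : M, EffectAlgebra.osum (f x) (f y) (f z) →
      EffectAlgebra.osum x y z) : EModCat.mk M ≅ EModCat.mk N :=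
  let e := Equiv.ofBijective f hf
  { hom := f
    inv :=
      ({ toFun := e.symm
         map_osum := fun {x y z} h => hosum _ _ _ (by
          rw [show f (e.symm x) = x from e.apply_symm_apply x,
            show f (e.symm y) = y from e.apply_symm_apply y,
            show f (e.symm z) = z from e.apply_symm_apply z]
          exact h)
         map_one := e.symm_apply_eq.2 f.map_one.symm
         map_smul := fun r x => e.symm_apply_eq.2 (by
          refine Eq.trans ?_ (f.map_smul r _).symm
          exact congrArg (EffectModule.smul r) (e.apply_symm_apply x).symm) } : EModHom N M)
    hom_inv_id := EModHom.ext (funext fun x => e.symm_apply_apply x)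
    inv_hom_id := EModHom.ext (funext fun x => e.apply_symm_apply x) }

/-! ### Comparison maps for a C⋆-algebra -/

section CStar

variable (A : Type u) [CStarAlgebra A]

/-- A state, as a map of effect modules on effects. -/
def probHom {A : Type u} [CStarAlgebra A] (s : Stat A) : EModDual (Effect A) where
  toFun := s.prob
  map_osum := fun {a b c} h => by
    change (s a.1).re + (s b.1).re = (s c.1).re
    rw [← Complex.add_re, ← map_add, show a.1 + b.1 = c.1 from h]
  map_one := Subtype.ext ((congrArg Complex.re s.apply_one).trans Complex.one_re)
  map_smul r a := Subtype.ext (by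
    refine (congrArg Complex.re (map_smul s ((r : ℝ) : ℂ) a.1)).trans ?_
    exact Complex.re_ofReal_mul _ _)

/-- The map of algebras `Stat(A) → EMod([0,1]_A,[0,1])`. -/
def statToDual : statAlgebra A ⟶ dualAlgebra (Effect A) where
  f := CompHausLike.ofHom _ ⟨fun s : Stat A => probHom s,
    EModDual.continuous_iff.2 fun a => Stat.continuous_prob a⟩
  h := by
    ext ν
    let ν' : Stat C(Stat A, ℂ) := ν
    refine EModHom.ext (funext fun a => Subtype.ext ?_)
    refine congrArg Complex.re (congrArg ν' (ContinuousMap.ext fun s => ?_))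
    exact Stat.prob_coe s a

theorem bijective_probHom : Function.Bijective (probHom : Stat A → EModDual (Effect A)) :=
  ⟨fun _ _ h => Stat.ext_prob fun x => DFunLike.congr_fun h x,
    fun φ => ⟨φ.toStat, DFunLike.ext _ _ φ.prob_toStat⟩⟩

/-- The map of effect modules `[0,1]_A → 𝒜(Stat(A),[0,1])`. -/
def effectToAff : EModHom (Effect A) (AffMap (statAlgebra A)) :=
  eModHomOfAlgebraHom (statToDual A)

theorem eq_of_forall_re_apply {a b : A} (ha : IsSelfAdjoint a) (hb : IsSelfAdjoint b)
    (h : ∀ s : Stat A, (s a).re = (s b).re) : a = b := by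
  have := Stat.norm_le_of_forall_abs_re_apply_le (ha.sub hb) le_rfl fun s => by
    rw [map_sub, Complex.sub_re, h, sub_self, abs_zero]
  exact sub_eq_zero.1 (norm_le_zero_iff.1 this)

theorem bijective_effectToAff : Function.Bijective (effectToAff A) := by
  refine ⟨fun a b h => Subtype.ext ?_, fun f => ?_⟩
  · exact eq_of_forall_re_apply A a.2.1.isSelfAdjoint b.2.1.isSelfAdjoint fun s =>
      congrArg Subtype.val (DFunLike.congr_fun h s)
  · obtain ⟨a, ha⟩ := exists_effect_prob_eq f
    exact ⟨a, DFunLike.ext _ _ ha⟩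

/-- Needed because a bijection preserving partial sums need not reflect them; here states separate
self-adjoint elements. -/
theorem osum_of_effectToAff {a b c : Effect A}
    (h : EffectAlgebra.osum (effectToAff A a) (effectToAff A b) (effectToAff A c)) :
    EffectAlgebra.osum a b c := by
  refine eq_of_forall_re_apply A (a.2.1.add b.2.1).isSelfAdjoint c.2.1.isSelfAdjoint fun s => ?_
  rw [map_add, Complex.add_re]
  exact h s

end CStar

/-! ### Comparison maps for a compact Hausdorff space -/

section Kleisli

variable (X : Type u) [TopologicalSpace X] [CompactSpace X]

/-- The continuous function `X → [0,1]` underlying an effect of `C(X, ℂ)`. -/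
def ofEffect (a : Effect C(X, ℂ)) : C(X, unitInterval) :=
  ⟨fun x => (dirac x).prob a, (Stat.continuous_prob a).comp continuous_dirac⟩

theorem toEffect_ofEffect (a : Effect C(X, ℂ)) : toEffect (ofEffect X a) = a :=
  Subtype.ext (ContinuousMap.ext fun x => Stat.prob_coe (dirac x) a)

/-- This is the C⋆-algebra case for `C(X, ℂ)`, transported along the identification of its effects
with continuous functions into `[0,1]`. -/
theorem bijective_mean : Function.Bijective (mean : Stat C(X, ℂ) → EModDual C(X, unitInterval)) := by
  constructor
  · intro ν₁ ν₂ h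
    refine Stat.ext_prob fun a => ?_
    rw [← toEffect_ofEffect X a]
    exact DFunLike.congr_fun h (ofEffect X a)
  · intro φ
    let ψ : EModDual (Effect C(X, ℂ)) := EModHom.comp φ
      { toFun := ofEffect X
        map_osum := fun h x => (probHom (dirac x)).map_osum h
        map_one := ContinuousMap.ext fun x => (probHom (dirac x)).map_one
        map_smul := fun r a => ContinuousMap.ext fun x => (probHom (dirac x)).map_smul r a }
    refine ⟨ψ.toStat, DFunLike.ext _ _ fun p => (ψ.prob_toStat (toEffect p)).trans ?_⟩
    exact congrArg φ (ContinuousMap.ext fun x => Subtype.ext rfl)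

end Kleisli

/-- The map of algebras `R(X) → EMod(Cont(X,[0,1]),[0,1])`. -/
def freeToDual (X : CompHaus.{u}) : radon.free.obj X ⟶ dualAlgebra C(X, unitInterval) where
  f := CompHausLike.ofHom _ ⟨fun ν : Stat C(X, ℂ) => mean ν,
    EModDual.continuous_iff.2 fun p => continuous_mean p⟩
  h := by
    ext Φ
    let Φ' : Stat C(Stat C(X, ℂ), ℂ) := Φ
    refine EModHom.ext (funext fun p => Subtype.ext ?_)
    refine congrArg Complex.re (congrArg Φ' (ContinuousMap.ext fun ν => ?_))
    exact mean_coe ν p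

/-- The map of effect modules `Cont(X,[0,1]) → 𝒜(R(X),[0,1])`. -/
def contToAff (X : CompHaus.{u}) : EModHom C(X, unitInterval) (AffMap (radon.free.obj X)) :=
  eModHomOfAlgebraHom (freeToDual X)

theorem contToAff_apply_dirac (X : CompHaus.{u}) (p : C(X, unitInterval)) (x : X) :
    contToAff X p (dirac x : Stat C(X, ℂ)) = p x := Subtype.ext rfl

/-- The inverse restricts an affine function to the Dirac states. -/
theorem bijective_contToAff (X : CompHaus.{u}) : Function.Bijective (contToAff X) := by
  refine ⟨fun p q h => ContinuousMap.ext fun x => ?_, fun f => ?_⟩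
  · rw [← contToAff_apply_dirac, h, contToAff_apply_dirac]
  · let p : C(X, unitInterval) :=
      ⟨fun x => f (dirac x : Stat C(X, ℂ)), f.continuous_toFun.comp continuous_dirac⟩
    refine ⟨p, DFunLike.ext _ _ fun ν => ?_⟩
    let ν' : Stat C(X, ℂ) := ν
    -- The integral formula is applied to `R(η)(ν)`, whose image under `μ` is `ν` by the unit law;
    -- it expresses `f ν` as the integral of `x ↦ f (dirac x)`.
    have h := f.apply_str (Stat.map (pullback ⟨dirac, continuous_dirac⟩) ν')
    have e : str (radon.free.obj X) (Stat.map (pullback ⟨dirac, continuous_dirac⟩) ν') = ν :=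
      PUMap.funext fun _ => rfl
    rw [e] at h
    rw [h]
    rfl

/-! ### The natural isomorphisms of the two triangles -/

/-- The comparison functor is `EMod(Cont(-,[0,1]),[0,1])`. -/
def klStatIso : klStat.{u} ≅ klPred.{u} ⋙ emodHom.{u} :=
  NatIso.ofComponents
    (fun X => algebraIsoOfBijective (freeToDual X.of) (bijective_mean X.of))
    (fun {X Y} f => by
      ext ν
      let ν' : Stat C(X.of, ℂ) := ν
      refine EModHom.ext (funext fun p => Subtype.ext ?_)
      refine congrArg Complex.re (congrArg ν' (ContinuousMap.ext fun x => ?_))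
      exact (mean_coe (f.of.hom.hom x : Stat C(Y.of, ℂ)) p).symm)

/-- `Cont(-,[0,1])` is `𝒜(R(-),[0,1])`. -/
def klPredIso : klStat.{u} ⋙ affHom.{u} ≅ klPred.{u} :=
  NatIso.ofComponents
    (fun X => (eModIsoOfBijective (contToAff X.of) (bijective_contToAff X.of)
      -- Partial sums are reflected because they are pointwise and Dirac states recover the values
      -- at points.
      fun p q r h x => by
        have := h (dirac x : Stat C(X.of, ℂ))
        rwa [contToAff_apply_dirac, contToAff_apply_dirac, contToAff_apply_dirac] at this).op)
    (fun {X Y} f => by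
      apply Quiver.Hom.unop_inj
      refine EModHom.ext (funext fun p => AffMap.ext (funext fun ν => ?_))
      let ν' : Stat C(X.of, ℂ) := ν
      refine Subtype.ext (congrArg Complex.re (congrArg ν' (ContinuousMap.ext fun x => ?_)))
      exact (mean_coe (f.of.hom.hom x : Stat C(Y.of, ℂ)) p).symm)

/-- The state functor on C⋆-algebras is `EMod([0,1]_(-),[0,1])`. -/
def cstarStatIso : cstarStat.{u} ≅ cstarPred.{u} ⋙ emodHom.{u} :=
  NatIso.ofComponents
    (fun A => algebraIsoOfBijective (statToDual A.unop.carrier) (bijective_probHom _))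
    (fun _ => by ext s; rfl)

/-- The effects of a C⋆-algebra are the affine functions on its states. -/
def cstarPredIso : cstarStat.{u} ⋙ affHom.{u} ≅ cstarPred.{u} :=
  NatIso.ofComponents
    (fun A => (eModIsoOfBijective (effectToAff A.unop.carrier) (bijective_effectToAff _)
      fun _ _ _ h => osum_of_effectToAff _ h).op)
    (fun _ => rfl)

end StateEffect

end

open Opposite StateEffect
theorem mainTheorem4 :
    -- the adjunction between `EModᵒᵖ` and `EM(R)`, given by exchanging arguments
    (∃ adj : affHom.{u} ⊣ emodHom.{u},
      ∀ (X : radon.{u}.Algebra) (M : EModCat.{u}ᵒᵖ) (f : affHom.obj X ⟶ M)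
        (x : X.A) (m : M.unop.carrier),
        dualEval ((adj.homEquiv X M f).f x) m = affEval (emodApply f.unop m) x) ∧
    -- the triangle over `Kl(R)`, in both directions
    (∃ e : klStat.{u} ≅ klPred.{u} ⋙ emodHom.{u},
      ∀ (X : Kleisli radon.{u}) (ν : Stat C(X.of, ℂ)) (p : C(X.of, unitInterval)),
        dualEval ((e.hom.app X).f ν) p = ν.prob (toEffect p)) ∧
    (∃ e : klStat.{u} ⋙ affHom.{u} ≅ klPred.{u},
      ∀ (X : Kleisli radon.{u}) (p : C(X.of, unitInterval)) (ν : Stat C(X.of, ℂ)),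
        affEval (emodApply (e.hom.app X).unop p) ν = ν.prob (toEffect p)) ∧
    -- the triangle over the opposite of the category of C⋆-algebras and PU maps,
    -- in both directions
    (∃ e : cstarStat.{u} ≅ cstarPred.{u} ⋙ emodHom.{u},
      ∀ (A : CStarPU.{u}) (s : Stat A.carrier) (a : Effect A.carrier),
        dualEval ((e.hom.app (op A)).f s) a = s.prob a) ∧
    (∃ e : cstarStat.{u} ⋙ affHom.{u} ≅ cstarPred.{u},
      ∀ (A : CStarPU.{u}) (a : Effect A.carrier) (s : Stat A.carrier),
        affEval (emodApply (e.hom.app (op A)).unop a) s = s.prob a) :=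
  ⟨⟨affHomAdjunction, fun X M f x m => by
      rw [affHomAdjunction, Adjunction.mkOfHomEquiv_homEquiv]
      rfl⟩,
    ⟨klStatIso, fun _ _ _ => rfl⟩, ⟨klPredIso, fun _ _ _ => rfl⟩,
    ⟨cstarStatIso, fun _ _ _ => rfl⟩, ⟨cstarPredIso, fun _ _ _ => rfl⟩⟩
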